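/- Let $D$ be the open unit disc, let $p\ge 1$ and $\alpha>-1$ be real, and let $A^p_\alpha$ be the weighted Bergman space of all analytic functions $f$ on $D$ with $\|f\|^p=\int_D|f|^p\,dA_\alpha<\infty$, where $dA_\alpha(z)=\frac{1+\alpha}{\pi}(1-|z|^2)^\alpha\,dA(z)$ and $dA$ is area measure. Let $\varphi$ be an elliptic automorphism of $D$, that is, a biholomorphic map of $D$ onto itself with exactly one fixed point in $D$, and suppose that $\varphi$ has infinite order, i.e. no iterate $\varphi_n$ with $n\ge 1$ is the identity. Let $\psi\in H^\infty$ be a bounded analytic function on $D$, and put $\psi_{(n)}=\prod_{j=0}^{n-1}\psi\circ\varphi_j$, where $\varphi_j$ is the $j$-th iterate of $\varphi$ and $\varphi_0$ is the identity. Then the limit $$\rho_{\psi,\varphi}=\lim_{n\to\infty}\|\psi_{(n)}\|_\infty^{1/n},\qquad \|g\|_\infty=\sup_{z\in D}|g(z)|,$$ exists, the weighted composition operator $C_{\psi,\varphi}f=\psi\cdot(f\circ\varphi)$ is a bounded linear operator on $A^p_\alpha$, and its spectral radius $\sup\{|\lambda| : \lambda\in\sigma(C_{\psi,\varphi})\}$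 equals $\rho_{\psi,\varphi}$. Moreover, if $a\in D$ is the fixed point of $\varphi$ and $v$ is the outer part of $\psi$, then $\rho_{\psi,\varphi}\ge|v(a)|$. Here $v$ is the outer factor in the inner-outer factorization $\psi=u\,v$ (which requires $\psi\not\equiv0$): $u$ is inner, i.e. bounded and analytic on $D$ with radial limits that exist and have modulus $1$ almost everywhere on the unit circle, and $v$ is outer, i.e. $$v(z)=c\,\exp\left(\frac1{2\pi}\int_0^{2\pi}\frac{e^{i\theta}+z}{e^{i\theta}-z}\,h(e^{i\theta})\,d\theta\right)\qquad(z\in D)$$ for some constant $c$ with $|c|=1$ and some real-valued integrable function $h$ on the unit circle. -/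

import Mathlib

open MeasureTheory Filter Topology
open scoped Complex.UnitDisc

noncomputable section

namespace WeightedComp

/-- A function on the open unit disc `𝔻`, extended by `0` to the complex plane. -/
def discExt (f : 𝔻 → ℂ) : ℂ → ℂ :=
  Function.extend (fun z : 𝔻 => (z : ℂ)) f 0

theorem discExt_coe (f : 𝔻 → ℂ) (z : 𝔻) : discExt f (z : ℂ) = f z :=
  Complex.UnitDisc.coe_injective.extend_apply f 0 z

theorem discExt_add (f g : 𝔻 → ℂ) : discExt (f + g) = discExt f + discExt g := by
  have h := Function.extend_add (fun z : 𝔻 => (z : ℂ)) f g (0 : ℂ → ℂ) 0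
  simpa [discExt] using h

theorem discExt_smul (c : ℂ) (f : 𝔻 → ℂ) : discExt (c • f) = c • discExt f := by
  have h := Function.extend_smul c (fun z : 𝔻 => (z : ℂ)) f (0 : ℂ → ℂ)
  simpa [discExt] using h

theorem discExt_zero : discExt 0 = 0 := by
  have h := discExt_smul 0 0
  simpa using h

/-- Holomorphic (complex analytic) functions on the open unit disc. -/
def IsHolo (f : 𝔻 → ℂ) : Prop :=
  DifferentiableOn ℂ (discExt f) (Metric.ball 0 1)

/-- The supremum norm of a function on the disc (used for bounded functions only). -/
def supNorm (f : 𝔻 → ℂ) : ℝ :=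
  ⨆ z : 𝔻, ‖f z‖

/-- Membership in `H^∞`: bounded holomorphic functions on the disc. -/
structure IsHInfty (f : 𝔻 → ℂ) : Prop where
  holo : IsHolo f
  bounded : BddAbove (Set.range fun z : 𝔻 => ‖f z‖)

/-- An elliptic automorphism: a biholomorphic map of the disc onto itself having
exactly one fixed point in the disc. -/
structure IsEllipticAut (φ : Equiv.Perm 𝔻) : Prop where
  holo : IsHolo fun z => (φ z : ℂ)
  holo_symm : IsHolo fun z => (φ.symm z : ℂ)
  unique_fixed : ∃! z : 𝔻, φ z = z

/-- The cocycle `ψ_(n) = ∏_{j < n} ψ ∘ φ_j`, where `φ_j` is the `j`-th iterate of `φ`. -/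
def cocycle (ψ : 𝔻 → ℂ) (φ : 𝔻 → 𝔻) (n : ℕ) : 𝔻 → ℂ :=
  fun z => ∏ j ∈ Finset.range n, ψ (φ^[j] z)

/-! ### Weighted Bergman spaces -/

/-- The measure `dA_α = (1 + α) / π * (1 - |z|^2)^α dA` on the unit disc. -/
def bergmanMeasure (α : ℝ) : Measure ℂ :=
  (volume.restrict (Metric.ball (0 : ℂ) 1)).withDensity
    fun z => ENNReal.ofReal ((1 + α) / Real.pi * (1 - ‖z‖ ^ 2) ^ α)

/-- The linear space of all holomorphic `f` on the disc with `∫ |f|^p dA_α < ∞`. -/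
def bergmanSubmodule (p α : ℝ) : Submodule ℂ (𝔻 → ℂ) where
  carrier := {f | IsHolo f ∧ MemLp (discExt f) (ENNReal.ofReal p) (bergmanMeasure α)}
  add_mem' := by
    rintro f g ⟨hf, hf'⟩ ⟨hg, hg'⟩
    refine ⟨?_, ?_⟩
    · unfold IsHolo
      rw [discExt_add]
      exact hf.add hg
    · rw [discExt_add]
      exact hf'.add hg'
  zero_mem' := by
    refine ⟨?_, ?_⟩
    · unfold IsHolo
      rw [discExt_zero]
      exact differentiableOn_const 0
    · rw [discExt_zero]
      exact MemLp.zero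
  smul_mem' := by
    rintro c f ⟨hf, hf'⟩
    refine ⟨?_, ?_⟩
    · unfold IsHolo
      rw [discExt_smul]
      exact hf.const_smul c
    · rw [discExt_smul]
      exact hf'.const_smul c

/-- The weighted Bergman space `A^p_α`. A separate type, so that it carries the norm topology
and not the topology of pointwise convergence. -/
def Bergman (p α : ℝ) : Type :=
  bergmanSubmodule p α

namespace Bergman

instance (p α : ℝ) : AddCommGroup (Bergman p α) :=
  inferInstanceAs (AddCommGroup (bergmanSubmodule p α))

instance (p α : ℝ) : Module ℂ (Bergman p α) :=
  inferInstanceAs (Module ℂ (bergmanSubmodule p α))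

instance (p α : ℝ) : CoeFun (Bergman p α) fun _ => 𝔻 → ℂ :=
  ⟨fun f => f.1⟩

/-- The embedding of `A^p_α` into `L^p(dA_α)`. -/
def toLp (p α : ℝ) :
    Bergman p α →ₗ[ℂ] Lp ℂ (ENNReal.ofReal p) (bergmanMeasure α) where
  toFun f := f.2.2.toLp (discExt f.1)
  map_add' f g := by
    rw [← MemLp.toLp_add]
    exact MemLp.toLp_congr _ _ (Eventually.of_forall fun z => congrFun (discExt_add f.1 g.1) z)
  map_smul' c f := by
    rw [RingHom.id_apply, ← MemLp.toLp_const_smul]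
    exact MemLp.toLp_congr _ _ (Eventually.of_forall fun z => congrFun (discExt_smul c f.1) z)

theorem toLp_injective (p α : ℝ) [hα : Fact (-1 < α)] : Function.Injective (toLp p α) := by
  rw [injective_iff_map_eq_zero]
  intro f hf
  have h0 : discExt f.1 =ᵐ[bergmanMeasure α] 0 :=
    (f.2.2.coeFn_toLp).symm.trans
      ((congrArg (fun g : Lp ℂ (ENNReal.ofReal p) (bergmanMeasure α) => (g : ℂ → ℂ)) hf) ▸
        Lp.coeFn_zero ℂ (ENNReal.ofReal p) (bergmanMeasure α))
  have hac : volume.restrict (Metric.ball (0 : ℂ) 1) ≪ bergmanMeasure α := by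
    refine withDensity_absolutelyContinuous' (by fun_prop) ?_
    filter_upwards [ae_restrict_mem Metric.isOpen_ball.measurableSet] with z hz
    have hz1 : ‖z‖ < 1 := by simpa using hz
    have h1 : 0 < 1 - ‖z‖ ^ 2 := by nlinarith [norm_nonneg z]
    have h2 : 0 < 1 + α := by linarith [hα.out]
    have h3 : 0 < (1 + α) / Real.pi * (1 - ‖z‖ ^ 2) ^ α :=
      mul_pos (div_pos h2 Real.pi_pos) (Real.rpow_pos_of_pos h1 α)
    exact (ENNReal.ofReal_pos.2 h3).ne'
  have h1 : Set.EqOn (discExt f.1) 0 (Metric.ball 0 1) :=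
    Measure.eqOn_open_of_ae_eq (hac.ae_eq h0) Metric.isOpen_ball f.2.1.continuousOn
      continuousOn_const
  refine Subtype.ext (funext fun z => ?_)
  have h2 := h1 (x := (z : ℂ)) (mem_ball_zero_iff.2 z.norm_lt_one)
  rw [discExt_coe] at h2
  exact h2

/-- The norm of `A^p_α`, namely `‖f‖ = (∫ |f|^p dA_α)^(1/p)`, the `L^p(dA_α)` norm. -/
instance (p α : ℝ) [Fact (1 ≤ p)] [Fact (-1 < α)] : NormedAddCommGroup (Bergman p α) :=
  haveI : Fact (1 ≤ ENNReal.ofReal p) := ⟨ENNReal.one_le_ofReal.2 Fact.out⟩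
  NormedAddCommGroup.induced (Bergman p α) (Lp ℂ (ENNReal.ofReal p) (bergmanMeasure α))
    (toLp p α) (toLp_injective p α)

instance (p α : ℝ) [Fact (1 ≤ p)] [Fact (-1 < α)] : NormedSpace ℂ (Bergman p α) :=
  haveI : Fact (1 ≤ ENNReal.ofReal p) := ⟨ENNReal.one_le_ofReal.2 Fact.out⟩
  NormedSpace.induced ℂ (Bergman p α) (Lp ℂ (ENNReal.ofReal p) (bergmanMeasure α)) (toLp p α)

end Bergman

/-! ### Inner and outer functions -/

/-- Inner functions: bounded holomorphic functions on the disc whose radial boundary values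
exist and are unimodular almost everywhere on the unit circle. -/
structure IsInner (u : 𝔻 → ℂ) : Prop where
  mem : IsHInfty u
  boundary : ∀ᵐ θ : ℝ, ∃ w : ℂ, ‖w‖ = 1 ∧
    Tendsto (fun r : ℝ => discExt u (circleMap 0 r θ)) (𝓝[<] 1) (𝓝 w)

/-- Outer functions:
`v(z) = c * exp ((1 / 2π) ∫_0^{2π} (e^{iθ} + z) / (e^{iθ} - z) * h(e^{iθ}) dθ)`
with `|c| = 1` and `h` a real-valued integrable function on the unit circle
(then `h = log |v|` almost everywhere on the circle). -/
def IsOuter (v : 𝔻 → ℂ) : Prop :=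
  ∃ (c : ℂ) (h : ℂ → ℝ), ‖c‖ = 1 ∧ CircleIntegrable h 0 1 ∧
    ∀ z : 𝔻, v z = c * Complex.exp
      (Real.circleAverage (fun ζ => herglotzRieszKernel 0 (z : ℂ) ζ * (h ζ : ℂ)) 0 1)

/-- `v` is the outer part of `ψ`: it is the outer factor in the inner-outer factorization
`ψ = u * v`. (It is unique up to a unimodular constant factor.) -/
def IsOuterPart (ψ v : 𝔻 → ℂ) : Prop :=
  IsOuter v ∧ ∃ u : 𝔻 → ℂ, IsInner u ∧ ∀ z, ψ z = u z * v z

end WeightedComp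

end

noncomputable section

namespace WeightedComp

open scoped ComplexConjugate

/-! ### Holomorphic automorphisms of the disc -/

/-! Everything rests on the fixed point `a`. Conjugation by the Möbius map that sends `0` to `a`
turns each automorphism fixing `a` into a rotation, by the Schwarz lemma. Rotations preserve `dA_α`,
so all iterates of `φ` and their inverses distort `dA_α` by at most one common constant
(`exists_map_bergmanMeasure_le`). The composition operators they induce are therefore bounded by one
constant `k`.

The power `T ^ n` is composition with `φ_n` followed by multiplication by `ψ_(n)`. A multiplication
operator on `A^p_α` has norm at least the sup norm of its symbol (`norm_le_norm_of_mul_apply`).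
Composing with `φ_n` or its inverse costs at most `k`, so `‖T ^ n‖` and `‖ψ_(n)‖_∞` agree up to the
factors `k` and `k⁻¹`. These disappear under `n`-th roots, and Gelfand's formula yields both the
existence of the limit and its value. The formula needs `A^p_α` complete; this follows from bounded
point evaluations, hence from the area mean value inequality.

For the outer part, put `τ_j = φ_j ∘ σ` with `σ 0 = a`, so that `τ_j 0 = a`. Formally, `log |v ∘
τ_j|` is harmonic with mean `log |v a|`, while `|ψ| = |v|` almost everywhere on the circle.
Averaging `log |ψ_(n) ∘ σ|` then gives `n log |v a| ≤ log ‖ψ_(n)‖_∞`. To avoid boundary values of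
`v` and of `u ∘ τ_j`, the averages are taken over `|z| = r` with `r → 1`. There the mean of `1 - |u
∘ τ_j|` tends to `0` (`IsInner.tendsto_circleAverage_comp`), and `log |v|` is controlled from above
by truncating its boundary function (`IsInner.nsmul_re_herglotzIntegral_le_log`). -/

theorem discExt_mk (f : 𝔻 → ℂ) {z : ℂ} (hz : ‖z‖ < 1) :
    discExt f z = f (Complex.UnitDisc.mk z hz) := by
  rw [← discExt_coe f, Complex.UnitDisc.coe_mk]

theorem discExt_of_one_le_norm (f : 𝔻 → ℂ) {z : ℂ} (hz : 1 ≤ ‖z‖) : discExt f z = 0 := by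
  refine Function.extend_apply' _ _ _ ?_
  rintro ⟨w, rfl⟩
  exact absurd w.norm_lt_one (not_lt.2 hz)

theorem IsHolo.congr {f : 𝔻 → ℂ} {g : ℂ → ℂ} (hg : DifferentiableOn ℂ g (Metric.ball 0 1))
    (h : ∀ z : 𝔻, f z = g z) : IsHolo f := by
  refine DifferentiableOn.congr hg fun z hz => ?_
  have hz' : ‖z‖ < 1 := by simpa using hz
  rw [discExt_mk f hz', h, Complex.UnitDisc.coe_mk]

theorem IsHolo.mul {f g : 𝔻 → ℂ} (hf : IsHolo f) (hg : IsHolo g) : IsHolo fun z => f z * g z := by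
  refine IsHolo.congr (DifferentiableOn.mul hf hg) fun z => ?_
  simp [discExt_coe]

theorem measurable_discExt {f : 𝔻 → ℂ} (hf : IsHolo f) : Measurable (discExt f) := by
  classical
  have h := ContinuousOn.measurable_piecewise (s := Metric.ball (0 : ℂ) 1)
    (DifferentiableOn.continuousOn hf)
    (continuousOn_const (c := (0 : ℂ)) (s := (Metric.ball (0 : ℂ) 1)ᶜ)) measurableSet_ball
  convert h using 1
  ext z
  by_cases hz : z ∈ Metric.ball (0 : ℂ) 1
  · simp [hz]
  · rw [Set.piecewise_eq_of_notMem _ _ _ hz]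
    exact discExt_of_one_le_norm _ (by simpa using hz)

/-- The extension by `0` to the plane of a self-map of the disc. -/
def discMap (η : 𝔻 → 𝔻) : ℂ → ℂ := discExt fun z => (η z : ℂ)

theorem discMap_coe (η : 𝔻 → 𝔻) (z : 𝔻) : discMap η z = η z := discExt_coe _ z

theorem discMap_mk (η : 𝔻 → 𝔻) {z : ℂ} (hz : ‖z‖ < 1) :
    discMap η z = η (Complex.UnitDisc.mk z hz) := discExt_mk _ hz

/-- Outside the disc the value is the default `0`, so the bound needs no condition on `z`. -/
theorem norm_discMap_lt (η : 𝔻 → 𝔻) (z : ℂ) : ‖discMap η z‖ < 1 := by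
  rcases lt_or_ge ‖z‖ 1 with hz | hz
  · rw [discMap_mk η hz]; exact (η _).norm_lt_one
  · rw [discMap, discExt_of_one_le_norm _ hz]; simp

theorem mapsTo_discMap (η : 𝔻 → 𝔻) (s : Set ℂ) :
    Set.MapsTo (discMap η) s (Metric.ball 0 1) := fun z _ => by
  simpa using norm_discMap_lt η z

theorem discExt_comp (f : 𝔻 → ℂ) (η : 𝔻 → 𝔻) {z : ℂ} (hz : ‖z‖ < 1) :
    discExt (fun w => f (η w)) z = discExt f (discMap η z) := by
  rw [discExt_mk _ hz, discMap_mk η hz, discExt_coe]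

theorem discMap_comp (η θ : 𝔻 → 𝔻) {z : ℂ} (hz : ‖z‖ < 1) :
    discMap (fun w => η (θ w)) z = discMap η (discMap θ z) :=
  discExt_comp (fun w => (η w : ℂ)) θ hz

theorem IsHolo.comp {f : 𝔻 → ℂ} {η : 𝔻 → 𝔻} (hf : IsHolo f) (hη : IsHolo fun z => (η z : ℂ)) :
    IsHolo fun z => f (η z) := by
  refine IsHolo.congr (DifferentiableOn.comp hf hη (mapsTo_discMap η _)) fun z => ?_
  change _ = discExt f (discMap η z)
  rw [discMap_coe, discExt_coe]

/-- Biholomorphic maps of the disc onto itself. -/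
structure IsDiscAut (η : Equiv.Perm 𝔻) : Prop where
  holo : IsHolo fun z => (η z : ℂ)
  holo_symm : IsHolo fun z => (η.symm z : ℂ)

theorem IsEllipticAut.isDiscAut {φ : Equiv.Perm 𝔻} (h : IsEllipticAut φ) : IsDiscAut φ :=
  ⟨h.holo, h.holo_symm⟩

theorem isHolo_coe : IsHolo fun z : 𝔻 => (z : ℂ) :=
  IsHolo.congr differentiableOn_id fun _ => rfl

namespace IsDiscAut

variable {η θ : Equiv.Perm 𝔻}

theorem one : IsDiscAut 1 := ⟨isHolo_coe, isHolo_coe⟩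

theorem inv (hη : IsDiscAut η) : IsDiscAut η⁻¹ := ⟨hη.holo_symm, hη.holo⟩

theorem mul (hη : IsDiscAut η) (hθ : IsDiscAut θ) : IsDiscAut (η * θ) :=
  ⟨hη.holo.comp hθ.holo, hθ.holo_symm.comp hη.holo_symm⟩

theorem pow (hη : IsDiscAut η) (n : ℕ) : IsDiscAut (η ^ n) := by
  induction n with
  | zero => exact one
  | succ n ih => rw [pow_succ]; exact ih.mul hη

theorem differentiableOn (hη : IsDiscAut η) : DifferentiableOn ℂ (discMap η) (Metric.ball 0 1) :=
  hη.holo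

end IsDiscAut

theorem discMap_symm_apply (η : Equiv.Perm 𝔻) {z : ℂ} (hz : ‖z‖ < 1) :
    discMap η.symm (discMap η z) = z := by
  rw [← discMap_comp _ _ hz, discMap_mk _ hz]; simp

theorem discMap_apply_symm (η : Equiv.Perm 𝔻) {z : ℂ} (hz : ‖z‖ < 1) :
    discMap η (discMap η.symm z) = z := by
  rw [← discMap_comp _ _ hz, discMap_mk _ hz]; simp

theorem discMap_image_ball (η : Equiv.Perm 𝔻) :
    discMap η '' Metric.ball 0 1 = Metric.ball 0 1 := by
  ext z
  constructor
  · rintro ⟨w, hw, rfl⟩; exact mapsTo_discMap η _ hw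
  · intro hz
    exact ⟨discMap η.symm z, mapsTo_discMap η.symm _ hz, discMap_apply_symm η (by simpa using hz)⟩

theorem injOn_discMap (η : Equiv.Perm 𝔻) : Set.InjOn (discMap η) (Metric.ball 0 1) := by
  intro z hz w hw h
  rw [← discMap_symm_apply η (z := z) (by simpa using hz), h,
    discMap_symm_apply η (by simpa using hw)]

/-- An automorphism of the disc fixing the origin is a rotation. -/
theorem IsDiscAut.exists_eq_mul {η : Equiv.Perm 𝔻} (hη : IsDiscAut η) (h0 : η 0 = 0) :
    ∃ c : ℂ, ‖c‖ = 1 ∧ ∀ z : 𝔻, (η z : ℂ) = c * z := by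
  -- The Schwarz lemma, applied to both `η` and its inverse, forces `|η z| = |z|`.
  have key : ∀ {θ : Equiv.Perm 𝔻}, IsDiscAut θ → θ 0 = 0 → ∀ z : 𝔻, ‖(θ z : ℂ)‖ ≤ ‖(z : ℂ)‖ := by
    intro θ hθ h z
    have := Complex.norm_le_norm_of_mapsTo_ball (z := (z : ℂ)) hθ.differentiableOn
      ((mapsTo_discMap θ _).mono_right Metric.ball_subset_closedBall)
      (by simpa [h] using discMap_coe θ 0) z.norm_lt_one
    rwa [discMap_coe] at this
  have hnorm : ∀ z : 𝔻, ‖(η z : ℂ)‖ = ‖(z : ℂ)‖ := fun z =>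
    le_antisymm (key hη h0 z) (by
      have := key hη.inv (by rw [Equiv.Perm.inv_eq_iff_eq, h0]) (η z)
      simpa using this)
  have hz0 : discMap η 0 = 0 := by simpa [h0] using discMap_coe η 0
  -- The equality case of the Schwarz lemma needs one nonzero point; `1 / 2` is an arbitrary choice.
  let w : 𝔻 := Complex.UnitDisc.mk (1 / 2) (by norm_num)
  have hw : (w : ℂ) = 1 / 2 := Complex.UnitDisc.coe_mk _ _
  have hw' : ‖discMap η (1 / 2)‖ = 1 / 2 := by
    rw [← hw, discMap_coe, hnorm, hw]; norm_num
  obtain ⟨c, hc, h⟩ := Complex.affine_of_mapsTo_ball_of_exists_norm_dslope_eq_div'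
    (f := discMap η) (c := 0) (R₁ := 1) (R₂ := 1) hη.differentiableOn
    (by rw [hz0]; exact (mapsTo_discMap η _).mono_right Metric.ball_subset_closedBall)
    ⟨1 / 2, by norm_num, by
      rw [dslope_of_ne _ (by norm_num), slope_def_module, hz0, sub_zero, sub_zero, norm_smul, hw']
      norm_num⟩
  refine ⟨c, by simpa using hc, fun z => ?_⟩
  have := h (x := (z : ℂ)) (by simpa using z.norm_lt_one)
  simpa [hz0, discMap_coe, mul_comm] using this

/-! ### Möbius maps -/

theorem one_add_conj_mul_ne_zero {a z : ℂ} (ha : ‖a‖ < 1) (hz : ‖z‖ < 1) :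
    1 + conj a * z ≠ 0 := by
  intro h
  have h1 : ‖conj a * z‖ = 1 := by
    rw [eq_neg_of_add_eq_zero_right h]; simp
  rw [norm_mul, RCLike.norm_conj] at h1
  nlinarith [norm_nonneg a, norm_nonneg z]

theorem one_sub_norm_sq_mobius {a z : ℂ} (ha : ‖a‖ < 1) (hz : ‖z‖ < 1) :
    1 - ‖(z + a) / (1 + conj a * z)‖ ^ 2 =
      (1 - ‖a‖ ^ 2) / ‖1 + conj a * z‖ ^ 2 * (1 - ‖z‖ ^ 2) := by
  have h := one_add_conj_mul_ne_zero ha hz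
  have h' : ‖1 + conj a * z‖ ≠ 0 := norm_ne_zero_iff.2 h
  have key : ‖1 + conj a * z‖ ^ 2 - ‖z + a‖ ^ 2 = (1 - ‖a‖ ^ 2) * (1 - ‖z‖ ^ 2) := by
    simp only [← Complex.normSq_eq_norm_sq, Complex.normSq_apply]
    simp
    ring
  rw [norm_div, div_mul_eq_mul_div, ← key, sub_div, div_self (pow_ne_zero 2 h'),
    div_pow]

theorem norm_mobius_lt_one {a z : ℂ} (ha : ‖a‖ < 1) (hz : ‖z‖ < 1) :
    ‖(z + a) / (1 + conj a * z)‖ < 1 := by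
  have h := one_sub_norm_sq_mobius ha hz
  have h' : 0 < ‖1 + conj a * z‖ := norm_pos_iff.2 (one_add_conj_mul_ne_zero ha hz)
  have h1 : 0 < 1 - ‖a‖ ^ 2 := by nlinarith [norm_nonneg a]
  have h2 : 0 < 1 - ‖z‖ ^ 2 := by nlinarith [norm_nonneg z]
  have h3 : 0 < (1 - ‖a‖ ^ 2) / ‖1 + conj a * z‖ ^ 2 * (1 - ‖z‖ ^ 2) := by positivity
  nlinarith [norm_nonneg ((z + a) / (1 + conj a * z))]

theorem mobius_neg_mobius {a z : ℂ} (ha : ‖a‖ < 1) (hz : ‖z‖ < 1) :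
    ((z + a) / (1 + conj a * z) + -a) / (1 + conj (-a) * ((z + a) / (1 + conj a * z))) = z := by
  have h := one_add_conj_mul_ne_zero ha hz
  have h2 := one_add_conj_mul_ne_zero (a := -a) (by simpa using ha) (norm_mobius_lt_one ha hz)
  rw [div_eq_iff h2, div_add' _ _ _ h, div_eq_iff h, map_neg]
  have h3 : (1 + -conj a * ((z + a) / (1 + conj a * z))) * (1 + conj a * z) =
      1 + conj a * z - conj a * (z + a) := by
    field_simp
    ring
  rw [mul_assoc, h3]
  ring

/-- The Möbius automorphism `z ↦ (z + a) / (1 + conj a * z)` of the disc. -/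
def mobius (a : 𝔻) : Equiv.Perm 𝔻 where
  toFun z := .mk (((z : ℂ) + a) / (1 + conj (a : ℂ) * z))
    (norm_mobius_lt_one a.norm_lt_one z.norm_lt_one)
  invFun z := .mk (((z : ℂ) + -a) / (1 + conj (-(a : ℂ)) * z))
    (norm_mobius_lt_one (by simpa using a.norm_lt_one) z.norm_lt_one)
  left_inv z := Complex.UnitDisc.coe_injective (by
    simpa using mobius_neg_mobius a.norm_lt_one z.norm_lt_one)
  right_inv z := Complex.UnitDisc.coe_injective (by
    simpa using mobius_neg_mobius (a := -a) (by simpa using a.norm_lt_one) z.norm_lt_one)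

theorem coe_mobius (a z : 𝔻) : (mobius a z : ℂ) = ((z : ℂ) + a) / (1 + conj (a : ℂ) * z) := rfl

theorem coe_mobius_symm (a z : 𝔻) : (mobius a).symm z = mobius (-a) z := by
  apply Complex.UnitDisc.coe_injective
  rw [coe_mobius]
  change ((z : ℂ) + -a) / (1 + conj (-(a : ℂ)) * z) = _
  simp

theorem mobius_zero (a : 𝔻) : mobius a 0 = a := by
  apply Complex.UnitDisc.coe_injective
  simp [coe_mobius]

theorem hasDerivAt_mobius {a z : ℂ} (ha : ‖a‖ < 1) (hz : ‖z‖ < 1) :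
    HasDerivAt (fun z : ℂ => (z + a) / (1 + conj a * z))
      ((1 - ‖a‖ ^ 2 : ℝ) / (1 + conj a * z) ^ 2) z := by
  have h := one_add_conj_mul_ne_zero ha hz
  have h1 := ((hasDerivAt_id' z).add_const a).div
    (((hasDerivAt_id' z).const_mul (conj a)).const_add 1) h
  refine h1.congr_deriv ?_
  congr 1
  push_cast
  rw [← Complex.mul_conj']
  ring

theorem isHolo_mobius (a : 𝔻) : IsHolo fun z => (mobius a z : ℂ) :=
  IsHolo.congr (fun _ hz => (hasDerivAt_mobius a.norm_lt_one
    (by simpa using hz)).differentiableAt.differentiableWithinAt) (coe_mobius a)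

theorem isDiscAut_mobius (a : 𝔻) : IsDiscAut (mobius a) :=
  ⟨isHolo_mobius a, by simpa only [coe_mobius_symm] using isHolo_mobius (-a)⟩

/-! ### Change of variables for the measures `dA_α` -/

/-- The determinant of multiplication by `c` is the field norm of `ℂ` over `ℝ`. It supplies the
Jacobian `|η'|²` of a holomorphic map. -/
theorem abs_det_smul_one (c : ℂ) : |(c • (1 : ℂ →L[ℝ] ℂ)).det| = ‖c‖ ^ 2 := by
  have h : ((c • (1 : ℂ →L[ℝ] ℂ) : ℂ →L[ℝ] ℂ) : ℂ →ₗ[ℝ] ℂ) = Algebra.lmul ℝ ℂ c := by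
    ext
    simp
  rw [ContinuousLinearMap.det, h, ← Complex.normSq_eq_norm_sq, ← Algebra.norm_complex_apply,
    ← Algebra.norm_apply, abs_of_nonneg]
  rw [Algebra.norm_complex_apply]
  exact Complex.normSq_nonneg c

/-- The density of `dA_α`. -/
def bergmanWeight (α : ℝ) (z : ℂ) : ENNReal :=
  ENNReal.ofReal ((1 + α) / Real.pi * (1 - ‖z‖ ^ 2) ^ α)

theorem measurable_bergmanWeight (α : ℝ) : Measurable (bergmanWeight α) := by
  unfold bergmanWeight; fun_prop

theorem bergmanMeasure_apply (α : ℝ) {s : Set ℂ} (hs : MeasurableSet s) :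
    bergmanMeasure α s =
      ∫⁻ z in Metric.ball 0 1, s.indicator (bergmanWeight α) z := by
  rw [bergmanMeasure, withDensity_apply _ hs, ← lintegral_indicator hs]
  rfl

/-- Change of variables `w = η z`: pulling `dA_α` back along `η` gives the density on the right of
`h`, so a lower bound for it by `c` bounds the push-forward by `c⁻¹`. -/
theorem map_bergmanMeasure_le {α : ℝ} (hα : -1 < α) {η : Equiv.Perm 𝔻} (hη : IsDiscAut η) {c : ℝ}
    (hc : 0 < c) (h : ∀ z : ℂ, ‖z‖ < 1 → c * (1 - ‖z‖ ^ 2) ^ α ≤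
      ‖deriv (discMap η) z‖ ^ 2 * (1 - ‖discMap η z‖ ^ 2) ^ α) :
    (bergmanMeasure α).map (discMap η) ≤ ENNReal.ofReal c⁻¹ • bergmanMeasure α := by
  have hm : Measurable (discMap η) := measurable_discExt hη.holo
  refine Measure.le_iff.2 fun s hs => ?_
  have key := lintegral_image_eq_lintegral_abs_det_fderiv_mul volume
    (s := Metric.ball (0 : ℂ) 1) (f := discMap η)
    (f' := fun z => deriv (discMap η) z • (1 : ℂ →L[ℝ] ℂ)) measurableSet_ball
    (fun z hz => ((hη.differentiableOn.differentiableAt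
      (Metric.isOpen_ball.mem_nhds hz)).hasDerivAt.complexToReal_fderiv).hasFDerivWithinAt)
    (injOn_discMap η) (s.indicator (bergmanWeight α))
  rw [discMap_image_ball] at key
  rw [Measure.map_apply hm hs, Measure.smul_apply, smul_eq_mul, bergmanMeasure_apply α hs, key,
    bergmanMeasure_apply α (hm hs), ← lintegral_const_mul' _ _ ENNReal.ofReal_ne_top]
  refine setLIntegral_mono' measurableSet_ball fun z hz => ?_
  have hz' : ‖z‖ < 1 := by simpa using hz
  by_cases hzs : discMap η z ∈ s
  · rw [Set.indicator_of_mem (show z ∈ discMap η ⁻¹' s from hzs), Set.indicator_of_mem hzs,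
      abs_det_smul_one, bergmanWeight, bergmanWeight, ← ENNReal.ofReal_mul (by positivity),
      ← ENNReal.ofReal_mul (by positivity)]
    refine ENNReal.ofReal_le_ofReal ?_
    have h1 := h z hz'
    have h2 : 0 ≤ (1 + α) / Real.pi := div_nonneg (by linarith) Real.pi_pos.le
    calc (1 + α) / Real.pi * (1 - ‖z‖ ^ 2) ^ α
        = c⁻¹ * ((1 + α) / Real.pi * (c * (1 - ‖z‖ ^ 2) ^ α)) := by field_simp
      _ ≤ c⁻¹ * ((1 + α) / Real.pi *
          (‖deriv (discMap η) z‖ ^ 2 * (1 - ‖discMap η z‖ ^ 2) ^ α)) := by gcongr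
      _ = _ := by ring
  · rw [Set.indicator_of_notMem (show z ∉ discMap η ⁻¹' s from hzs)]
    exact zero_le

theorem deriv_discMap_eq {η : 𝔻 → 𝔻} {g : ℂ → ℂ} (h : ∀ z : 𝔻, (η z : ℂ) = g z) {z : ℂ}
    (hz : ‖z‖ < 1) : deriv (discMap η) z = deriv g z := by
  refine Filter.EventuallyEq.deriv_eq ?_
  filter_upwards [Metric.isOpen_ball.mem_nhds (show z ∈ Metric.ball (0 : ℂ) 1 by simpa using hz)]
    with w hw
  rw [discMap_mk η (by simpa using hw), h, Complex.UnitDisc.coe_mk]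

/-- The pulled-back density is `((1 - |a|²) / |1 + āz|²) ^ (2 + α) * (1 - |z|²) ^ α`: the Jacobian
contributes the exponent `2`, the weight contributes `α`. The `4` comes from `|1 + āz| ≤ 2`. -/
theorem map_bergmanMeasure_mobius_le {α : ℝ} (hα : -1 < α) (a : 𝔻) :
    (bergmanMeasure α).map (discMap (mobius a)) ≤
      ENNReal.ofReal (((1 - ‖(a : ℂ)‖ ^ 2) / 4) ^ (2 + α))⁻¹ • bergmanMeasure α := by
  have ha : 0 < 1 - ‖(a : ℂ)‖ ^ 2 := by nlinarith [a.norm_lt_one, norm_nonneg (a : ℂ)]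
  refine map_bergmanMeasure_le hα (isDiscAut_mobius a) (by positivity) fun z hz => ?_
  have hz2 : 0 < 1 - ‖z‖ ^ 2 := by nlinarith [norm_nonneg z]
  have hne := one_add_conj_mul_ne_zero a.norm_lt_one hz
  have hpos : 0 < ‖1 + conj (a : ℂ) * z‖ := norm_pos_iff.2 hne
  rw [deriv_discMap_eq (g := fun z : ℂ => (z + a) / (1 + conj (a : ℂ) * z)) (coe_mobius a) hz, (hasDerivAt_mobius a.norm_lt_one hz).deriv,
    discMap_mk _ hz, coe_mobius, Complex.UnitDisc.coe_mk, one_sub_norm_sq_mobius a.norm_lt_one hz,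
    norm_div, norm_pow, Complex.norm_real, Real.norm_of_nonneg ha.le,
    Real.mul_rpow (by positivity) hz2.le, ← mul_assoc,
    ← Real.rpow_natCast ((1 - ‖(a : ℂ)‖ ^ 2) / ‖1 + conj (a : ℂ) * z‖ ^ 2) 2,
    ← Real.rpow_add (by positivity), Nat.cast_ofNat]
  gcongr
  · linarith
  · have : ‖1 + conj (a : ℂ) * z‖ ≤ 2 := by
      refine (norm_add_le _ _).trans ?_
      rw [norm_mul, RCLike.norm_conj, norm_one]
      nlinarith [a.norm_lt_one, norm_nonneg (a : ℂ), norm_nonneg z]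
    nlinarith

theorem map_bergmanMeasure_rotation_le {α : ℝ} (hα : -1 < α) {η : Equiv.Perm 𝔻}
    (hη : IsDiscAut η) {c : ℂ} (hc : ‖c‖ = 1) (h : ∀ z : 𝔻, (η z : ℂ) = c * z) :
    (bergmanMeasure α).map (discMap η) ≤ bergmanMeasure α := by
  have := map_bergmanMeasure_le hα hη one_pos fun z hz => ?_
  · simpa using this
  · rw [deriv_discMap_eq h hz, discMap_mk _ hz, h, Complex.UnitDisc.coe_mk]
    simp [hc]

theorem ae_bergmanMeasure_norm_lt (α : ℝ) : ∀ᵐ z ∂bergmanMeasure α, ‖z‖ < 1 := by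
  refine (withDensity_absolutelyContinuous _ _).ae_le ?_
  filter_upwards [ae_restrict_mem measurableSet_ball] with z hz
  simpa using hz

theorem map_discMap_mul_le {α : ℝ} {η θ : Equiv.Perm 𝔻} (hη : IsDiscAut η) (hθ : IsDiscAut θ)
    {K L : ENNReal} (h : (bergmanMeasure α).map (discMap η) ≤ K • bergmanMeasure α)
    (h' : (bergmanMeasure α).map (discMap θ) ≤ L • bergmanMeasure α) :
    (bergmanMeasure α).map (discMap (η * θ : Equiv.Perm 𝔻)) ≤ (L * K) • bergmanMeasure α := by
  have hm : Measurable (discMap η) := measurable_discExt hη.holo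
  have hm' : Measurable (discMap θ) := measurable_discExt hθ.holo
  have h1 : (bergmanMeasure α).map (discMap (η * θ : Equiv.Perm 𝔻)) =
      ((bergmanMeasure α).map (discMap θ)).map (discMap η) := by
    rw [Measure.map_map hm hm']
    refine Measure.map_congr ?_
    filter_upwards [ae_bergmanMeasure_norm_lt α] with z hz
    exact discMap_comp η θ hz
  rw [h1]
  calc _ ≤ (L • bergmanMeasure α).map (discMap η) := Measure.map_mono h' hm
    _ = L • (bergmanMeasure α).map (discMap η) := Measure.map_smul _ _ _
    _ ≤ L • K • bergmanMeasure α := by gcongr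
    _ = _ := smul_smul _ _ _

/-- The automorphisms fixing a given point distort `dA_α` in a uniformly bounded way. -/
theorem exists_map_bergmanMeasure_le {α : ℝ} (hα : -1 < α) (a : 𝔻) :
    ∃ K : ENNReal, K ≠ 0 ∧ K ≠ ⊤ ∧ ∀ η : Equiv.Perm 𝔻, IsDiscAut η → η a = a →
      (bergmanMeasure α).map (discMap η) ≤ K • bergmanMeasure α := by
  set K := ENNReal.ofReal (((1 - ‖(a : ℂ)‖ ^ 2) / 4) ^ (2 + α))⁻¹ with hK
  have ha : 0 < 1 - ‖(a : ℂ)‖ ^ 2 := by nlinarith [a.norm_lt_one, norm_nonneg (a : ℂ)]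
  have hK0 : K ≠ 0 := (ENNReal.ofReal_pos.2 (by positivity)).ne'
  have hKt : K ≠ ⊤ := ENNReal.ofReal_ne_top
  -- One factor `K` for each of `σ` and `σ⁻¹`, and `1` for the rotation between them; none depends
  -- on `η`.
  refine ⟨K * 1 * K, by simp [hK0], by finiteness, fun η hη hηa => ?_⟩
  set σ := mobius a
  have hσ : IsDiscAut σ := isDiscAut_mobius a
  have hσ0 : σ 0 = a := mobius_zero a
  have h0 : (σ⁻¹ * η * σ) 0 = 0 := by
    rw [Equiv.Perm.mul_apply, Equiv.Perm.mul_apply, hσ0, hηa, Equiv.Perm.inv_eq_iff_eq, hσ0]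
  have hconj : IsDiscAut (σ⁻¹ * η * σ) := (hσ.inv.mul hη).mul hσ
  obtain ⟨c, hc, hrot⟩ := hconj.exists_eq_mul h0
  have h1 := map_bergmanMeasure_mobius_le hα a
  have h2 : (bergmanMeasure α).map (discMap (σ⁻¹ : Equiv.Perm 𝔻)) ≤ K • bergmanMeasure α := by
    have h3 := map_bergmanMeasure_mobius_le hα (-a)
    have h4 : ((σ⁻¹ : Equiv.Perm 𝔻) : 𝔻 → 𝔻) = mobius (-a) := funext (coe_mobius_symm a)
    rw [h4]
    simpa [hK] using h3
  have h3 : (bergmanMeasure α).map (discMap (σ⁻¹ * η * σ : Equiv.Perm 𝔻)) ≤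
      (1 : ENNReal) • bergmanMeasure α := by
    simpa using map_bergmanMeasure_rotation_le hα hconj hc hrot
  have h4 := map_discMap_mul_le hσ (hconj.mul hσ.inv) h1 (map_discMap_mul_le hconj hσ.inv h3 h2)
  have h5 : σ * (σ⁻¹ * η * σ * σ⁻¹) = η := by group
  rwa [h5] at h4

/-! ### The space `A^p_α`: finiteness of `dA_α`, point evaluations, completeness -/

/-- In polar coordinates the integrand becomes `y * (1 - y²) ^ α`, which has an explicit
antiderivative, continuous up to `y = 1` because `α + 1 > 0`. -/
theorem integrableOn_one_sub_sq_rpow {α : ℝ} (hα : -1 < α) :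
    IntegrableOn (fun z : ℂ => (1 - ‖z‖ ^ 2) ^ α) (Metric.ball 0 1) := by
  rw [integrableOn_fun_norm_addHaar volume (f := fun y : ℝ => (1 - y ^ 2) ^ α)]
  have hα1 : 0 < α + 1 := by linarith
  have hd : ∀ x ∈ Set.Ioo (0 : ℝ) 1,
      HasDerivAt (fun y : ℝ => -(1 - y ^ 2) ^ (α + 1) / (2 * (α + 1))) (x * (1 - x ^ 2) ^ α) x := by
    intro x hx
    have hx1 : 0 < 1 - x ^ 2 := by nlinarith [hx.1, hx.2]
    have h := ((((hasDerivAt_pow 2 x).const_sub 1).rpow_const (p := α + 1)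
      (Or.inl hx1.ne')).neg.div_const (2 * (α + 1)))
    refine h.congr_deriv ?_
    rw [add_sub_cancel_right]
    field_simp
    simp [mul_comm]
  have h := intervalIntegral.integrableOn_deriv_of_nonneg (a := (0 : ℝ)) (b := 1)
    (g := fun y : ℝ => -(1 - y ^ 2) ^ (α + 1) / (2 * (α + 1)))
    (ContinuousOn.div_const (ContinuousOn.neg (ContinuousOn.rpow_const (by fun_prop)
      fun _ _ => Or.inr hα1.le)) _) hd (fun x hx => mul_nonneg hx.1.le
      (Real.rpow_nonneg (by nlinarith [hx.1, hx.2]) _))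
  simpa using h.mono_set Set.Ioo_subset_Ioc_self

theorem isFiniteMeasure_bergmanMeasure {α : ℝ} (hα : -1 < α) :
    IsFiniteMeasure (bergmanMeasure α) :=
  isFiniteMeasure_withDensity_ofReal
    ((integrableOn_one_sub_sq_rpow hα).const_mul ((1 + α) / Real.pi)).hasFiniteIntegral

/-- Mean value property on one circle. The left side is kept as an integral of a constant over the
angles of polar coordinates, so that integrating in `r` gives the area version. -/
theorem enorm_mul_two_pi_le_lintegral {F : ℂ → ℂ} {z : ℂ} {r : ℝ} (hr : 0 < r)
    (hF : DiffContOnCl ℂ F (Metric.ball z r)) :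
    ∫⁻ _ in Set.Ioo (-Real.pi) Real.pi, ‖F z‖ₑ ≤
      ∫⁻ θ in Set.Ioo (-Real.pi) Real.pi, ‖F (circleMap z r θ)‖ₑ := by
  have h1 : Real.circleAverage F z r = F z :=
    DiffContOnCl.circleAverage (by rwa [abs_of_pos hr])
  have h2 : (2 * Real.pi) • F z = ∫ θ in Set.Ioo (-Real.pi) Real.pi, F (circleMap z r θ) := by
    rw [← integral_Ioc_eq_integral_Ioo,
      ← intervalIntegral.integral_of_le (by linarith [Real.pi_pos]), ← h1,
      Real.circleAverage_eq_integral_add (-Real.pi), smul_inv_smul₀ (by positivity),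
      intervalIntegral.integral_comp_add_right (fun θ => F (circleMap z r θ))]
    congr 1 <;> ring
  calc _ = ‖(2 * Real.pi) • F z‖ₑ := by
        rw [setLIntegral_const, Real.volume_Ioo, enorm_smul, Real.enorm_of_nonneg (by positivity),
          mul_comm]
        congr 2; ring
    _ ≤ _ := by rw [h2]; exact enorm_integral_le_lintegral_enorm _

/-- The area mean value inequality. -/
theorem enorm_mul_volume_ball_le_lintegral {F : ℂ → ℂ} (hm : Measurable F) {z : ℂ} {δ : ℝ}
    (hF : DifferentiableOn ℂ F (Metric.ball z δ)) :
    ‖F z‖ₑ * volume (Metric.ball z δ) ≤ ∫⁻ w in Metric.ball z δ, ‖F w‖ₑ := by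
  have hpre : (fun w : ℂ => w + z) ⁻¹' Metric.ball z δ = Metric.ball 0 δ := by
    ext w; simp
  have polar : ∀ G : ℂ → ENNReal, Measurable G →
      ∫⁻ w in Metric.ball z δ, G w = ∫⁻ r in Set.Ioi (0 : ℝ), ∫⁻ θ in Set.Ioo (-Real.pi) Real.pi,
        (Set.Iio δ).indicator (fun r => ENNReal.ofReal r * G (circleMap z r θ)) r := by
    intro G hG
    have hG' : Measurable fun w : ℂ => (Metric.ball (0 : ℂ) δ).indicator (fun w => G (w + z)) w :=
      (hG.comp (measurable_id.add_const z)).indicator measurableSet_ball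
    rw [← (measurePreserving_add_right volume z).setLIntegral_comp_preimage measurableSet_ball hG,
      hpre, ← lintegral_indicator measurableSet_ball, ← Complex.lintegral_comp_polarCoord_symm,
      polarCoord_target, Measure.volume_eq_prod, ← Measure.prod_restrict, lintegral_prod]
    · refine setLIntegral_congr_fun measurableSet_Ioi fun r hr => ?_
      refine setLIntegral_congr_fun measurableSet_Ioo fun θ _ => ?_
      have hr0 : 0 < r := hr
      have h1 : Complex.polarCoord.symm (r, θ) + z = circleMap z r θ := by
        rw [Complex.polarCoord_symm_apply, circleMap, Complex.exp_mul_I]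
        push_cast; ring
      have h2 : ‖Complex.polarCoord.symm (r, θ)‖ = r := by simp [abs_of_pos hr0]
      by_cases hrδ : r < δ
      · rw [Set.indicator_of_mem (by rw [mem_ball_zero_iff, h2]; exact hrδ), Set.indicator_of_mem (by simpa using hrδ),
          h1, smul_eq_mul]
      · rw [Set.indicator_of_notMem (by rw [mem_ball_zero_iff, h2]; exact hrδ),
          Set.indicator_of_notMem (by simpa using hrδ), smul_zero]
    · refine Measurable.aemeasurable ?_
      have : Measurable fun p : ℝ × ℝ => Complex.polarCoord.symm p := by
        simp only [Complex.polarCoord_symm_apply]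
        fun_prop
      simp only [smul_eq_mul]
      exact (ENNReal.measurable_ofReal.comp measurable_fst).mul (hG'.comp this)
  rw [← setLIntegral_const, polar _ measurable_const, polar _ hm.enorm]
  refine setLIntegral_mono' measurableSet_Ioi fun r hr => ?_
  by_cases hrδ : r < δ
  · simp only [Set.indicator_of_mem (show r ∈ Set.Iio δ from hrδ)]
    rw [lintegral_const_mul' _ _ ENNReal.ofReal_ne_top,
      lintegral_const_mul' _ _ ENNReal.ofReal_ne_top]
    refine mul_le_mul_right ?_ _
    refine enorm_mul_two_pi_le_lintegral hr (DifferentiableOn.diffContOnCl ?_)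
    rw [closure_ball z (ne_of_gt hr)]
    exact hF.mono (Metric.closedBall_subset_ball hrδ)
  · simp [Set.indicator_of_notMem (show r ∉ Set.Iio δ from hrδ)]

theorem lintegral_bergmanMeasure (α : ℝ) {F : ℂ → ENNReal} (hF : Measurable F) :
    ∫⁻ z, F z ∂bergmanMeasure α = ∫⁻ z in Metric.ball 0 1, bergmanWeight α z * F z :=
  lintegral_withDensity_eq_lintegral_mul _ (measurable_bergmanWeight α) hF

/-- For `α ≥ 0` the weight is smallest at `|z| = R`, for `α ≤ 0` at the origin; the minimum in the
witness covers both. -/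
theorem exists_le_bergmanWeight {α R : ℝ} (hα : -1 < α) (hR : R < 1) :
    ∃ c : ENNReal, c ≠ 0 ∧ c ≠ ⊤ ∧ ∀ z : ℂ, ‖z‖ ≤ R → c ≤ bergmanWeight α z := by
  have hα1 : 0 < (1 + α) / Real.pi := div_pos (by linarith) Real.pi_pos
  have hpos : 0 < 1 - R ^ 2 ∨ R < 0 := by
    rcases lt_or_ge R 0 with h | h
    · exact Or.inr h
    · left; nlinarith
  rcases hpos with h | h
  swap
  · exact ⟨1, one_ne_zero, ENNReal.one_ne_top, fun z hz => absurd hz (by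
      have := norm_nonneg z; linarith)⟩
  refine ⟨ENNReal.ofReal ((1 + α) / Real.pi * min 1 ((1 - R ^ 2) ^ α)),
    (ENNReal.ofReal_pos.2 (by positivity)).ne', ENNReal.ofReal_ne_top, fun z hz => ?_⟩
  have h1 : 1 - R ^ 2 ≤ 1 - ‖z‖ ^ 2 := by nlinarith [norm_nonneg z]
  refine ENNReal.ofReal_le_ofReal (mul_le_mul_of_nonneg_left ?_ hα1.le)
  rcases le_total 0 α with h0 | h0
  · exact (min_le_right _ _).trans (Real.rpow_le_rpow h.le h1 h0)
  · exact (min_le_left _ _).trans (Real.one_le_rpow_of_pos_of_le_one_of_nonpos (h.trans_le h1)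
      (by nlinarith [norm_nonneg z]) h0)

variable {p α : ℝ}

theorem Bergman.norm_def [Fact (1 ≤ p)] [Fact (-1 < α)] (f : Bergman p α) :
    ‖f‖ = (eLpNorm (discExt f) (ENNReal.ofReal p) (bergmanMeasure α)).toReal :=
  Lp.norm_toLp _ f.2.2

theorem Bergman.enorm_def [Fact (1 ≤ p)] [Fact (-1 < α)] (f : Bergman p α) :
    ‖f‖ₑ = eLpNorm (discExt f) (ENNReal.ofReal p) (bergmanMeasure α) := by
  rw [← ofReal_norm, norm_def, ENNReal.ofReal_toReal f.2.2.eLpNorm_ne_top]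

/-- Point evaluations are bounded on `A^p_α`, uniformly on compact subsets of the disc. -/
theorem Bergman.exists_norm_apply_le (p α : ℝ) [Fact (1 ≤ p)] [hα : Fact (-1 < α)] {R : ℝ}
    (hR : R < 1) : ∃ C : ℝ, ∀ (f : Bergman p α) (z : 𝔻), ‖(z : ℂ)‖ ≤ R → ‖f z‖ ≤ C * ‖f‖ := by
  have := isFiniteMeasure_bergmanMeasure hα.out
  -- Discs of radius `δ = (1 - R) / 2` centred in `|z| ≤ R` stay inside `|w| < (R + 1) / 2`, where
  -- the weight is bounded below.
  obtain ⟨c, hc0, hct, hc⟩ := exists_le_bergmanWeight hα.out (show (R + 1) / 2 < 1 by linarith)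
  set δ := (1 - R) / 2 with hδ
  have hδ0 : 0 < δ := by linarith
  set V := volume (Metric.ball (0 : ℂ) δ) with hV
  have hV0 : V ≠ 0 := (Metric.measure_ball_pos volume _ hδ0).ne'
  have hVt : V ≠ ⊤ := measure_ball_lt_top.ne
  -- Hölder constant for passing from the `L^p` norm to the `L^1` norm on a finite measure space.
  set M := bergmanMeasure α Set.univ ^ (1 / (1 : ENNReal).toReal - 1 / (ENNReal.ofReal p).toReal)
  have hp : 1 ≤ p := Fact.out
  have hMt : M ≠ ⊤ := by
    refine ENNReal.rpow_ne_top_of_nonneg ?_ (measure_ne_top _ _)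
    rw [ENNReal.toReal_ofReal (by linarith), ENNReal.toReal_one]
    have : 1 / p ≤ 1 := by rw [div_le_one (by linarith)]; exact hp
    linarith
  set C := M * c⁻¹ * V⁻¹
  have hCt : C ≠ ⊤ := by
    have := ENNReal.inv_ne_top.2 hc0
    have := ENNReal.inv_ne_top.2 hV0
    finiteness
  refine ⟨C.toReal, fun f z hz => ?_⟩
  have hm := measurable_discExt f.2.1
  have hsub : Metric.ball (z : ℂ) δ ⊆ Metric.ball 0 1 := by
    refine Metric.ball_subset_ball' ?_
    rw [dist_zero_right]; linarith
  have h1 := enorm_mul_volume_ball_le_lintegral hm (DifferentiableOn.mono f.2.1 hsub)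
  rw [discExt_coe, Measure.addHaar_ball_center] at h1
  have h2 : ∫⁻ w in Metric.ball (z : ℂ) δ, ‖discExt f w‖ₑ ≤
      c⁻¹ * ∫⁻ w, ‖discExt f w‖ₑ ∂bergmanMeasure α := by
    rw [lintegral_bergmanMeasure α hm.enorm, ← lintegral_const_mul' _ _ (ENNReal.inv_ne_top.2 hc0)]
    refine (setLIntegral_mono' measurableSet_ball fun w hw => ?_).trans
      (lintegral_mono_set hsub)
    have hw' : ‖w‖ ≤ (R + 1) / 2 := by
      have h3 : ‖w - z‖ < δ := by simpa [dist_eq_norm] using hw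
      have h4 := norm_add_le (w - z) z
      rw [sub_add_cancel] at h4
      linarith
    calc ‖discExt f w‖ₑ = c⁻¹ * (c * ‖discExt f w‖ₑ) := by
          rw [← mul_assoc, ENNReal.inv_mul_cancel hc0 hct, one_mul]
      _ ≤ _ := by
          exact mul_le_mul_right (mul_le_mul_left (hc w hw') _) _
  have h3 : ∫⁻ w, ‖discExt f w‖ₑ ∂bergmanMeasure α ≤ ‖f‖ₑ * M := by
    rw [← eLpNorm_one_eq_lintegral_enorm, enorm_def]
    exact eLpNorm_le_eLpNorm_mul_rpow_measure_univ (ENNReal.one_le_ofReal.2 hp)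
      hm.aestronglyMeasurable
  have h4 : ‖f z‖ₑ ≤ C * ‖f‖ₑ := by
    calc ‖f z‖ₑ = ‖f z‖ₑ * V * V⁻¹ := by
          rw [mul_assoc, ENNReal.mul_inv_cancel hV0 hVt, mul_one]
      _ ≤ c⁻¹ * (‖f‖ₑ * M) * V⁻¹ := by
          exact mul_le_mul_left (h1.trans (h2.trans (mul_le_mul_right h3 _))) _
      _ = C * ‖f‖ₑ := by ring
  have h5 := ENNReal.toReal_mono (ENNReal.mul_ne_top hCt enorm_ne_top) h4
  simpa [ENNReal.toReal_mul] using h5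

theorem Bergman.sub_apply (f g : Bergman p α) (z : 𝔻) : (f - g) z = f z - g z := rfl

/-- Bounded point evaluations make a Cauchy sequence converge locally uniformly, so its pointwise
limit is holomorphic. Its `L^p` limit is the same function, since a subsequence converges to it
almost everywhere. -/
instance [Fact (1 ≤ p)] [hα : Fact (-1 < α)] : CompleteSpace (Bergman p α) := by
  have hp : Fact (1 ≤ ENNReal.ofReal p) := ⟨ENNReal.one_le_ofReal.2 Fact.out⟩
  refine Metric.complete_of_cauchySeq_tendsto fun f hf => ?_
  have hunif : ∀ R < 1, UniformCauchySeqOn (fun n => discExt (f n)) atTop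
      (Metric.closedBall 0 R) := by
    intro R hR
    obtain ⟨C, hC⟩ := Bergman.exists_norm_apply_le p α hR
    rw [Metric.uniformCauchySeqOn_iff]
    intro ε hε
    obtain ⟨N, hN⟩ := Metric.cauchySeq_iff.1 hf (ε / (|C| + 1)) (by positivity)
    refine ⟨N, fun m hm n hn z hz => ?_⟩
    have hz' : ‖z‖ ≤ R := by simpa using hz
    rw [discExt_mk _ (hz'.trans_lt hR), discExt_mk _ (hz'.trans_lt hR), dist_eq_norm,
      ← Bergman.sub_apply]
    refine (hC _ (.mk z (hz'.trans_lt hR)) hz').trans_lt ?_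
    have h1 := hN m hm n hn
    rw [dist_eq_norm, lt_div_iff₀ (by positivity)] at h1
    nlinarith [le_abs_self C, norm_nonneg (f m - f n), abs_nonneg C]
  have hpt : ∀ z : 𝔻, ∃ w, Tendsto (fun n => f n z) atTop (𝓝 w) := by
    intro z
    refine cauchySeq_tendsto_of_complete ?_
    have := (hunif ‖(z : ℂ)‖ z.norm_lt_one).cauchySeq (x := (z : ℂ)) (by simp)
    simpa only [discExt_coe] using this
  choose g hg using hpt
  have hpt' : ∀ z : ℂ, Tendsto (fun n => discExt (f n) z) atTop (𝓝 (discExt g z)) := by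
    intro z
    rcases lt_or_ge ‖z‖ 1 with hz | hz
    · simp only [discExt_mk _ hz]; exact hg _
    · simp only [discExt_of_one_le_norm _ hz]; exact tendsto_const_nhds
  have hloc : TendstoLocallyUniformlyOn (fun n => discExt (f n)) (discExt g) atTop
      (Metric.ball 0 1) := by
    rw [tendstoLocallyUniformlyOn_iff_forall_isCompact Metric.isOpen_ball]
    intro K hK hKc
    obtain ⟨R, hR, hKR⟩ : ∃ R < 1, K ⊆ Metric.closedBall (0 : ℂ) R := by
      rcases K.eq_empty_or_nonempty with rfl | hne
      · exact ⟨0, one_pos, Set.empty_subset _⟩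
      · obtain ⟨x, hx, hmax⟩ := hKc.exists_isMaxOn hne continuous_norm.continuousOn
        exact ⟨‖x‖, by simpa using hK hx, fun y hy => by simpa using hmax hy⟩
    exact ((hunif R hR).tendstoUniformlyOn_of_tendsto fun z _ => hpt' z).mono hKR
  have hgh : IsHolo g := hloc.differentiableOn
    (Eventually.of_forall fun n => (f n).2.1) Metric.isOpen_ball
  -- The norm is induced along `toLp`, so the two distances agree by definition.
  have hcau : CauchySeq fun n => Bergman.toLp p α (f n) := by
    rw [Metric.cauchySeq_iff] at hf ⊢
    exact hf
  obtain ⟨G, hG⟩ := cauchySeq_tendsto_of_complete hcau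
  have hcoe : ∀ᵐ z ∂bergmanMeasure α, ∀ n, Bergman.toLp p α (f n) z = discExt (f n) z :=
    ae_all_iff.2 fun n => (f n).2.2.coeFn_toLp
  obtain ⟨ns, hmono, hns⟩ := (tendstoInMeasure_of_tendsto_Lp hG).exists_seq_tendsto_ae
  have hGg : G =ᵐ[bergmanMeasure α] discExt g := by
    filter_upwards [hns, hcoe] with z hz hz'
    simp only [hz'] at hz
    exact tendsto_nhds_unique hz ((hpt' z).comp hmono.tendsto_atTop)
  let g' : Bergman p α := ⟨g, hgh, (memLp_congr_ae hGg).1 (Lp.memLp G)⟩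
  have hg' : Bergman.toLp p α g' = G := by
    refine Lp.ext ?_
    exact (MemLp.coeFn_toLp g'.2.2).trans hGg.symm
  refine ⟨g', ?_⟩
  rw [← hg'] at hG
  rw [tendsto_iff_dist_tendsto_zero] at hG ⊢
  exact hG

/-! ### Weighted composition operators -/

theorem norm_le_supNorm {g : 𝔻 → ℂ} (hg : IsHInfty g) (z : 𝔻) : ‖g z‖ ≤ supNorm g :=
  le_ciSup hg.bounded z

theorem supNorm_le {g : 𝔻 → ℂ} {B : ℝ} (h : ∀ z, ‖g z‖ ≤ B) : supNorm g ≤ B :=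
  ciSup_le h

theorem supNorm_nonneg (g : 𝔻 → ℂ) : 0 ≤ supNorm g :=
  Real.iSup_nonneg fun _ => norm_nonneg _

theorem supNorm_one : supNorm (fun _ => 1) = 1 := by simp [supNorm]

theorem isHInfty_one : IsHInfty fun _ => 1 :=
  ⟨IsHolo.congr (differentiableOn_const 1) fun _ => rfl, 1, by rintro _ ⟨z, rfl⟩; simp⟩

theorem IsHInfty.mul {f g : 𝔻 → ℂ} (hf : IsHInfty f) (hg : IsHInfty g) :
    IsHInfty fun z => f z * g z := by
  refine ⟨hf.holo.mul hg.holo, supNorm f * supNorm g, ?_⟩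
  rintro _ ⟨z, rfl⟩
  simp only [norm_mul]
  exact mul_le_mul (norm_le_supNorm hf z) (norm_le_supNorm hg z) (norm_nonneg _)
    (supNorm_nonneg f)

theorem IsHInfty.comp {f : 𝔻 → ℂ} (hf : IsHInfty f) {η : Equiv.Perm 𝔻} (hη : IsDiscAut η) :
    IsHInfty fun z => f (η z) :=
  ⟨hf.holo.comp hη.holo, supNorm f, by rintro _ ⟨z, rfl⟩; exact norm_le_supNorm hf _⟩

theorem cocycle_succ (ψ : 𝔻 → ℂ) (φ : 𝔻 → 𝔻) (n : ℕ) (z : 𝔻) :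
    cocycle ψ φ (n + 1) z = cocycle ψ φ n z * ψ (φ^[n] z) :=
  Finset.prod_range_succ _ _

theorem IsHInfty.cocycle {ψ : 𝔻 → ℂ} (hψ : IsHInfty ψ) {φ : Equiv.Perm 𝔻} (hφ : IsDiscAut φ)
    (n : ℕ) : IsHInfty (cocycle ψ φ n) := by
  induction n with
  | zero =>
    rw [show WeightedComp.cocycle ψ φ 0 = fun _ => 1 from funext fun z => Finset.prod_range_zero _]
    exact isHInfty_one
  | succ n ih =>
    have h := ih.mul (hψ.comp (hφ.pow n))
    rwa [show WeightedComp.cocycle ψ φ (n + 1) =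
      fun z => WeightedComp.cocycle ψ φ n z * ψ ((φ ^ n) z) from
        funext fun z => by rw [cocycle_succ, ← Equiv.Perm.iterate_eq_pow]]

theorem Bergman.ext {f g : Bergman p α} (h : ∀ z, f z = g z) : f = g :=
  Subtype.ext (funext h)

/-- The integral of `|f ∘ η|^p` is that of `|f|^p` against the push-forward of `dA_α`, hence the
factor `K ^ (1 / p)`. The general `g` and `η` cover the operator itself, its powers, and composition
with inverse iterates. -/
theorem exists_weightedComp [hp : Fact (1 ≤ p)] [Fact (-1 < α)] {g : 𝔻 → ℂ} (hg : IsHInfty g)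
    {η : Equiv.Perm 𝔻} (hη : IsDiscAut η) {K : ENNReal} (hK0 : K ≠ 0) (hKt : K ≠ ⊤)
    (hK : (bergmanMeasure α).map (discMap η) ≤ K • bergmanMeasure α) :
    ∃ T : Bergman p α →L[ℂ] Bergman p α, (∀ f z, T f z = g z * f (η z)) ∧
      ‖T‖ ≤ supNorm g * (K ^ (1 / p)).toReal := by
  have hp0 : 0 < p := one_pos.trans_le hp.out
  have hm : Measurable (discMap η) := measurable_discExt hη.holo
  have key : ∀ f : 𝔻 → ℂ, IsHolo f →
      eLpNorm (discExt fun z => g z * f (η z)) (ENNReal.ofReal p) (bergmanMeasure α) ≤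
        ENNReal.ofReal (supNorm g) * (K ^ (1 / p) *
          eLpNorm (discExt f) (ENNReal.ofReal p) (bergmanMeasure α)) := by
    intro f hf
    have hfm := measurable_discExt hf
    calc _ ≤ ENNReal.ofReal (supNorm g) * eLpNorm (discExt f ∘ discMap η) (ENNReal.ofReal p)
          (bergmanMeasure α) := by
          refine eLpNorm_le_mul_eLpNorm_of_ae_le_mul ?_ _
          filter_upwards [ae_bergmanMeasure_norm_lt α] with z hz
          rw [Function.comp_apply, ← discExt_comp f η hz, discExt_mk _ hz, discExt_mk _ hz,
            norm_mul]
          gcongr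
          exact norm_le_supNorm hg _
      _ = ENNReal.ofReal (supNorm g) * eLpNorm (discExt f) (ENNReal.ofReal p)
          ((bergmanMeasure α).map (discMap η)) := by
          rw [eLpNorm_map_measure hfm.aestronglyMeasurable hm.aemeasurable]
      _ ≤ ENNReal.ofReal (supNorm g) * eLpNorm (discExt f) (ENNReal.ofReal p)
          (K • bergmanMeasure α) := by
          gcongr
      _ = _ := by
          rw [eLpNorm_smul_measure_of_ne_zero hK0, smul_eq_mul, ENNReal.toReal_div,
            ENNReal.toReal_ofReal hp0.le, ENNReal.toReal_one]
  have hKp : K ^ (1 / p) ≠ ⊤ := ENNReal.rpow_ne_top_of_nonneg (by positivity) hKt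
  have hmem : ∀ f : Bergman p α, (fun z => g z * f (η z)) ∈ bergmanSubmodule p α := by
    intro f
    refine ⟨hg.holo.mul (IsHolo.comp f.2.1 hη.holo), (measurable_discExt
      (hg.holo.mul (IsHolo.comp f.2.1 hη.holo))).aestronglyMeasurable, ?_⟩
    refine (key _ f.2.1).trans_lt ?_
    have := f.2.2.eLpNorm_ne_top
    finiteness
  let T₀ : Bergman p α →ₗ[ℂ] Bergman p α :=
    { toFun := fun f => ⟨fun z => g z * f (η z), hmem f⟩
      map_add' := fun f₁ f₂ => Bergman.ext fun z => mul_add _ _ _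
      map_smul' := fun c f => Bergman.ext fun z => mul_left_comm _ _ _ }
  refine ⟨T₀.mkContinuous (supNorm g * (K ^ (1 / p)).toReal) fun f => ?_, fun f z => rfl,
    LinearMap.mkContinuous_norm_le _ (mul_nonneg (supNorm_nonneg g) ENNReal.toReal_nonneg) _⟩
  rw [Bergman.norm_def, Bergman.norm_def]
  refine (ENNReal.toReal_mono ?_ (key _ f.2.1)).trans_eq ?_
  · have := f.2.2.eLpNorm_ne_top
    finiteness
  · rw [ENNReal.toReal_mul, ENNReal.toReal_mul, ENNReal.toReal_ofReal (supNorm_nonneg g), mul_assoc]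

/-- Evaluating `M ^ k` on the constant `1` at `z` gives `|g z|^k ≤ C * ‖M‖^k` with `C` independent
of `k`; for large `k` this excludes `|g z| > ‖M‖`. -/
theorem norm_le_norm_of_mul_apply [Fact (1 ≤ p)] [hα : Fact (-1 < α)] {g : 𝔻 → ℂ}
    {M : Bergman p α →L[ℂ] Bergman p α} (hM : ∀ f z, M f z = g z * f z) (z : 𝔻) :
    ‖g z‖ ≤ ‖M‖ := by
  have := isFiniteMeasure_bergmanMeasure hα.out
  let e : Bergman p α := ⟨fun _ => 1, isHInfty_one.holo,
    (MemLp.of_bound (measurable_discExt isHInfty_one.holo).aestronglyMeasurable 1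
      (Eventually.of_forall fun z => by
        rcases lt_or_ge ‖z‖ 1 with hz | hz
        · simp [discExt_mk _ hz]
        · simp [discExt_of_one_le_norm _ hz]))⟩
  obtain ⟨C, hC⟩ := Bergman.exists_norm_apply_le p α z.norm_lt_one
  have hpow : ∀ k : ℕ, (M ^ k) e z = g z ^ k := by
    intro k
    induction k with
    | zero => rfl
    | succ k ih =>
      rw [pow_succ', mul_apply_eq_comp, hM, ih, pow_succ']
  have hbound : ∀ k : ℕ, ‖g z‖ ^ k ≤ |C| * ‖e‖ * ‖M‖ ^ k := by
    intro k
    rw [← norm_pow, ← hpow]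
    refine (hC _ z le_rfl).trans ?_
    have h1 : ‖(M ^ k) e‖ ≤ ‖M‖ ^ k * ‖e‖ :=
      ((M ^ k).le_opNorm e).trans (by
        gcongr
        rcases k.eq_zero_or_pos with rfl | hk
        · exact ContinuousLinearMap.norm_id_le
        · exact norm_pow_le' M hk)
    calc C * ‖(M ^ k) e‖ ≤ |C| * (‖M‖ ^ k * ‖e‖) := by
          gcongr
          exact le_abs_self C
      _ = _ := by ring
  by_contra! hlt
  rcases (norm_nonneg M).eq_or_lt with h0 | h0
  · have := hbound 1
    rw [← h0] at this hlt
    simp at this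
    simp [this] at hlt
  · have h1 : 1 < ‖g z‖ / ‖M‖ := (one_lt_div h0).2 hlt
    obtain ⟨k, hk⟩ := pow_unbounded_of_one_lt (|C| * ‖e‖) h1
    rw [div_pow, lt_div_iff₀ (by positivity)] at hk
    exact absurd (hbound k) (not_le.2 hk)

theorem tendsto_const_rpow_one_div {k : ℝ} (hk : 0 < k) :
    Tendsto (fun n : ℕ => k ^ (1 / (n : ℝ))) atTop (𝓝 1) := by
  have h := tendsto_one_div_atTop_nhds_zero_nat (𝕜 := ℝ)
  have := (Real.continuousAt_const_rpow hk.ne' (b := 0)).tendsto.comp h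
  simpa [Function.comp_def] using this

/-- The spectral radius formula for `C_{ψ,φ}` when `φ` has a fixed point. -/
theorem exists_tendsto_and_spectralRadius (p α : ℝ) [Fact (1 ≤ p)] [hα : Fact (-1 < α)]
    {φ : Equiv.Perm 𝔻} (hφ : IsDiscAut φ) {a : 𝔻} (ha : φ a = a) {ψ : 𝔻 → ℂ} (hψ : IsHInfty ψ) :
    ∃ ρ : ℝ,
      Tendsto (fun n : ℕ => supNorm (cocycle ψ φ n) ^ (1 / (n : ℝ))) atTop (𝓝 ρ) ∧
      ∃ T : Bergman p α →L[ℂ] Bergman p α,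
        (∀ f z, T f z = ψ z * f (φ z)) ∧ spectralRadius ℂ T = ENNReal.ofReal ρ := by
  obtain ⟨K, hK0, hKt, hK⟩ := exists_map_bergmanMeasure_le hα.out a
  obtain ⟨T, hT, -⟩ := exists_weightedComp (p := p) hψ hφ hK0 hKt (hK φ hφ ha)
  have hp : (1 : ℝ) ≤ p := Fact.out
  set k := (K ^ (1 / p)).toReal
  have hk : 0 < k := ENNReal.toReal_pos (by
    rw [Ne, ENNReal.rpow_eq_zero_iff]; simp [hK0, hKt])
    (ENNReal.rpow_ne_top_of_nonneg (by positivity) hKt)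
  have hpow : ∀ (n : ℕ) (f : Bergman p α) (z : 𝔻),
      (T ^ n) f z = cocycle ψ φ n z * f ((φ ^ n) z) := by
    intro n
    induction n with
    | zero => intro f z; simp [cocycle]
    | succ n ih =>
      intro f z
      rw [pow_succ, mul_apply_eq_comp, ih, hT, cocycle_succ, mul_assoc,
        ← Equiv.Perm.iterate_eq_pow, ← Equiv.Perm.iterate_eq_pow, Function.iterate_succ_apply']
  -- All iterates fix `a`, so one constant `K` serves every `n`.
  have hfix : ∀ n : ℕ, (φ ^ n) a = a := fun n => by
    rw [← Equiv.Perm.iterate_eq_pow]; exact Function.iterate_fixed ha n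
  have hupper : ∀ n : ℕ, ‖T ^ n‖ ≤ k * supNorm (cocycle ψ φ n) := by
    intro n
    obtain ⟨S, hS, hSn⟩ := exists_weightedComp (p := p) (hψ.cocycle hφ n) (hφ.pow n) hK0 hKt
      (hK _ (hφ.pow n) (hfix n))
    have : T ^ n = S := ContinuousLinearMap.ext fun f => Bergman.ext fun z => by rw [hpow, hS]
    rw [this, mul_comm]
    exact hSn
  -- Undoing the composition by `D`, which composes with the inverse of `φ ^ n`, leaves `T ^ n * D`
  -- as multiplication by the cocycle.
  have hlower : ∀ n : ℕ, supNorm (cocycle ψ φ n) ≤ k * ‖T ^ n‖ := by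
    intro n
    obtain ⟨D, hD, hDn⟩ := exists_weightedComp (p := p) isHInfty_one (hφ.pow n).inv hK0 hKt
      (hK _ (hφ.pow n).inv (by rw [Equiv.Perm.inv_eq_iff_eq, hfix]))
    rw [supNorm_one, one_mul] at hDn
    refine supNorm_le fun z => (norm_le_norm_of_mul_apply (M := T ^ n * D) (fun f z => ?_) z).trans ?_
    · rw [mul_apply_eq_comp, hpow, hD, one_mul, Equiv.Perm.inv_def,
        Equiv.symm_apply_apply]
    · rw [mul_comm k]
      exact (norm_mul_le _ _).trans (by gcongr)
  have hgel := spectrum.pow_norm_pow_one_div_tendsto_nhds_spectralRadius T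
  have hfin : spectralRadius ℂ T ≠ ⊤ := by
    refine ne_top_of_le_ne_top ?_ (spectrum.spectralRadius_le_pow_nnnorm_pow_one_div ℂ T 0)
    simp [ENNReal.mul_eq_top]
  have hreal : Tendsto (fun n : ℕ => ‖T ^ n‖ ^ (1 / n : ℝ)) atTop
      (𝓝 (spectralRadius ℂ T).toReal) := by
    have h1 := (ENNReal.tendsto_toReal hfin).comp hgel
    refine h1.congr fun n => ?_
    exact ENNReal.toReal_ofReal (by positivity)
  refine ⟨(spectralRadius ℂ T).toReal, ?_, T, hT, (ENNReal.ofReal_toReal hfin).symm⟩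
  refine tendsto_of_tendsto_of_tendsto_of_le_of_le
    (by simpa using (tendsto_const_rpow_one_div (inv_pos.2 hk)).mul hreal)
    (by simpa using (tendsto_const_rpow_one_div hk).mul hreal) (fun n => ?_) (fun n => ?_)
  · rw [one_div, ← Real.mul_rpow (by positivity) (norm_nonneg _)]
    refine Real.rpow_le_rpow (by positivity) ?_ (by positivity)
    rw [inv_mul_le_iff₀ hk]
    exact hupper n
  · rw [one_div, ← Real.mul_rpow (by positivity) (norm_nonneg _)]
    exact Real.rpow_le_rpow (supNorm_nonneg _) (hlower n) (by positivity)

/-! ### Poisson integrals -/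

open Real (circleAverage)

theorem norm_circleAverage_le (f : ℂ → ℂ) (c : ℂ) (R : ℝ) :
    ‖circleAverage f c R‖ ≤ circleAverage (fun z => ‖f z‖) c R := by
  rw [circleAverage, circleAverage, norm_smul, smul_eq_mul,
    Real.norm_of_nonneg (inv_nonneg.2 Real.two_pi_pos.le)]
  exact mul_le_mul_of_nonneg_left (intervalIntegral.norm_integral_le_integral_norm
    Real.two_pi_pos.le) (inv_nonneg.2 Real.two_pi_pos.le)

theorem le_poissonKernel {R : ℝ} {z ζ : ℂ} (hζ : ζ ∈ Metric.sphere (0 : ℂ) R) (hz : ‖z‖ < R) :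
    (R - ‖z‖) / (R + ‖z‖) ≤ poissonKernel 0 z ζ := by
  rw [poissonKernel_eq_re_herglotzRieszKernel]
  simpa [herglotzRieszKernel_def] using le_re_herglotzRieszKernel hζ (by simpa using hz)

theorem poissonKernel_le {R : ℝ} {z ζ : ℂ} (hζ : ζ ∈ Metric.sphere (0 : ℂ) R) (hz : ‖z‖ < R) :
    poissonKernel 0 z ζ ≤ (R + ‖z‖) / (R - ‖z‖) := by
  rw [poissonKernel_eq_re_herglotzRieszKernel]
  simpa [herglotzRieszKernel_def] using re_herglotzRieszKernel_le hζ (by simpa using hz)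

theorem poissonKernel_nonneg {R : ℝ} {z ζ : ℂ} (hζ : ζ ∈ Metric.sphere (0 : ℂ) R) (hz : ‖z‖ < R) :
    0 ≤ poissonKernel 0 z ζ :=
  (div_nonneg (by linarith) (by linarith [norm_nonneg z])).trans (le_poissonKernel hζ hz)

theorem continuousOn_poissonKernel {R : ℝ} {z : ℂ} (hz : ‖z‖ < R) :
    ContinuousOn (poissonKernel 0 z) (Metric.sphere 0 |R|) := by
  rw [poissonKernel_eq_re_herglotzRieszKernel]
  exact Complex.continuous_re.comp_continuousOn
    (continuousOn_herglotzRieszKernel_sphere (by simpa using hz))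

theorem circleIntegrable_poissonKernel_mul {R : ℝ} {z : ℂ} (hz : ‖z‖ < R) {k : ℂ → ℝ}
    (hk : CircleIntegrable k 0 R) : CircleIntegrable (fun ζ => poissonKernel 0 z ζ * k ζ) 0 R :=
  hk.continuousOn_mul (continuousOn_poissonKernel hz)

theorem circleAverage_poissonKernel_mul_const {R : ℝ} {z : ℂ} (hz : ‖z‖ < R) (c : ℝ) :
    circleAverage (fun ζ => poissonKernel 0 z ζ * c) 0 R = c := by
  have h : Real.circleAverage (poissonKernel 0 z • fun _ : ℂ => (c : ℂ)) 0 R = c :=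
    DiffContOnCl.circleAverage_poissonKernel_smul (f := fun _ : ℂ => (c : ℂ))
      (differentiable_const (c : ℂ)).diffContOnCl (by simpa using hz)
  have h1 : CircleIntegrable (fun ζ => poissonKernel 0 z ζ * c) 0 R :=
    circleIntegrable_poissonKernel_mul hz (circleIntegrable_const c 0 R)
  have h2 := Complex.ofRealCLM.circleAverage_comp_comm h1
  apply Complex.ofReal_injective
  rw [← h]
  refine Eq.trans h2.symm ?_
  congr 1
  ext ζ
  simp

/-- The Herglotz integral over the circle of radius `R` of a real-valued function `k`. Its real
part is the Poisson integral of `k`. -/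
def herglotzIntegral (k : ℂ → ℝ) (R : ℝ) (z : ℂ) : ℂ :=
  circleAverage (fun ζ => herglotzRieszKernel 0 z ζ • (k ζ : ℂ)) 0 R

theorem re_herglotzIntegral {k : ℂ → ℝ} {R : ℝ} (hk : CircleIntegrable k 0 R) {z : ℂ}
    (hz : ‖z‖ < R) : (herglotzIntegral k R z).re =
      circleAverage (fun ζ => poissonKernel 0 z ζ * k ζ) 0 R := by
  rw [herglotzIntegral, re_circleAverage_herglotzRieszKernel_smul hk (by simpa using hz),
    poissonKernel_eq_re_herglotzRieszKernel]
  rfl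

theorem differentiableOn_herglotzIntegral {k : ℂ → ℝ} {R : ℝ} (hk : CircleIntegrable k 0 R) :
    DifferentiableOn ℂ (herglotzIntegral k R) (Metric.ball 0 R) :=
  differentiableOn_circleAverage_herglotzRieszKernel_smul (f := fun ζ => (k ζ : ℂ)) (by
    simp only [CircleIntegrable, intervalIntegrable_iff] at hk ⊢
    exact Complex.ofRealCLM.integrable_comp hk)

/-- The mean value property of the real part of a holomorphic function. -/
theorem circleAverage_re_eq {F : ℂ → ℂ} {r s : ℝ} (hr : 0 < r) (hrs : r < s)
    (hF : DifferentiableOn ℂ F (Metric.ball 0 s)) :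
    circleAverage (fun ζ => (F ζ).re) 0 r = (F 0).re := by
  have hsub : Metric.closedBall (0 : ℂ) r ⊆ Metric.ball 0 s := Metric.closedBall_subset_ball hrs
  have h1 : circleAverage F 0 r = F 0 := by
    refine DiffContOnCl.circleAverage (DifferentiableOn.diffContOnCl ?_)
    rw [abs_of_pos hr, closure_ball _ hr.ne']
    exact hF.mono hsub
  have h2 : CircleIntegrable F 0 r :=
    (hF.continuousOn.mono (Metric.sphere_subset_closedBall.trans hsub)).circleIntegrable hr.le
  have h3 := Complex.reCLM.circleAverage_comp_comm h2
  rw [← h1]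
  exact h3

/-- The Poisson formula for `F` together with positivity of the kernel: subharmonicity of `|F|`. -/
theorem norm_le_circleAverage_poissonKernel {F : ℂ → ℂ} {r s : ℝ} (hr : 0 < r) (hrs : r < s)
    (hF : DifferentiableOn ℂ F (Metric.ball 0 s)) {z : ℂ} (hz : ‖z‖ < r) :
    ‖F z‖ ≤ circleAverage (fun ζ => poissonKernel 0 z ζ * ‖F ζ‖) 0 r := by
  have hsub : Metric.closedBall (0 : ℂ) r ⊆ Metric.ball 0 s := Metric.closedBall_subset_ball hrs
  have h1 : Real.circleAverage (poissonKernel 0 z • F) 0 r = F z := by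
    refine DiffContOnCl.circleAverage_poissonKernel_smul (DifferentiableOn.diffContOnCl ?_)
      (by simpa using hz)
    rw [closure_ball _ hr.ne']
    exact hF.mono hsub
  rw [← h1]
  refine (norm_circleAverage_le _ _ _).trans_eq (Real.circleAverage_congr_sphere fun ζ hζ => ?_)
  rw [abs_of_pos hr] at hζ
  simp [abs_of_nonneg (poissonKernel_nonneg hζ hz)]

/-! ### Boundary behaviour of inner functions -/

theorem circleIntegrable_of_continuousOn_ball {E : Type*} [NormedAddCommGroup E] {F : ℂ → E}
    {r s : ℝ} (hr : 0 < r) (hrs : r < s) (hF : ContinuousOn F (Metric.ball 0 s)) :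
    CircleIntegrable F 0 r :=
  (hF.mono (Metric.sphere_subset_closedBall.trans
    (Metric.closedBall_subset_ball hrs))).circleIntegrable hr.le

theorem eventually_mem_Ioo {a : ℝ} (ha : a < 1) : ∀ᶠ r : ℝ in 𝓝[<] 1, r ∈ Set.Ioo a 1 :=
  Ioo_mem_nhdsLT ha

namespace IsInner

variable {u : 𝔻 → ℂ}

/-- Dominated convergence from the radial limits. Only this mean form of the boundary condition is
used afterwards. -/
theorem tendsto_circleAverage_abs (hu : IsInner u) :
    Tendsto (fun r => circleAverage (fun w => |‖discExt u w‖ - 1|) 0 r) (𝓝[<] 1) (𝓝 0) := by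
  have hm := measurable_discExt hu.mem.holo
  have hb : ∀ w, ‖discExt u w‖ ≤ supNorm u := fun w => by
    rcases lt_or_ge ‖w‖ 1 with hw | hw
    · rw [discExt_mk _ hw]; exact norm_le_supNorm hu.mem _
    · rw [discExt_of_one_le_norm _ hw, norm_zero]; exact supNorm_nonneg u
  have h := intervalIntegral.tendsto_integral_filter_of_dominated_convergence
    (μ := volume) (a := 0) (b := 2 * Real.pi) (l := 𝓝[<] (1 : ℝ))
    (F := fun r θ => |‖discExt u (circleMap 0 r θ)‖ - 1|) (f := fun _ => (0 : ℝ))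
    (fun _ => supNorm u + 1)
    (Eventually.of_forall fun r =>
      ((hm.comp (measurable_circleMap 0 r)).norm.sub_const 1).abs.aestronglyMeasurable)
    (Eventually.of_forall fun r => Eventually.of_forall fun θ _ => by
      rw [Real.norm_eq_abs, abs_abs]
      refine (abs_sub _ _).trans ?_
      rw [abs_norm, abs_one]
      exact add_le_add_left (hb _) _)
    intervalIntegrable_const
    (hu.boundary.mono fun θ ⟨w, hw, hlim⟩ _ => by
      have h1 := (hlim.norm.sub_const 1).abs
      rwa [hw, sub_self, abs_zero] at h1)
  have h2 := h.const_smul (2 * Real.pi)⁻¹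
  simpa [circleAverage] using h2

theorem differentiableOn (hu : IsInner u) : DifferentiableOn ℂ (discExt u) (Metric.ball 0 1) :=
  hu.mem.holo

theorem circleIntegrable_abs (hu : IsInner u) {r : ℝ} (hr : r ∈ Set.Ioo (0 : ℝ) 1) :
    CircleIntegrable (fun w => |‖discExt u w‖ - 1|) 0 r :=
  circleIntegrable_of_continuousOn_ball hr.1 hr.2
    (hu.differentiableOn.continuousOn.norm.sub continuousOn_const).abs

/-- Bound `|u z|` by the Poisson integral of `1 + ||u| - 1|` over `|ζ| = r`. The constant
contributes `1`; the rest is at most the maximum of the kernel times a mean that tends to `0` as `r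
→ 1`. -/
theorem norm_discExt_le_one (hu : IsInner u) (z : ℂ) : ‖discExt u z‖ ≤ 1 := by
  rcases lt_or_ge ‖z‖ 1 with hz | hz
  swap
  · rw [discExt_of_one_le_norm _ hz]; simp
  set A := fun r => circleAverage (fun w => |‖discExt u w‖ - 1|) 0 r
  have hlim : Tendsto (fun r : ℝ => 1 + (r + ‖z‖) / (r - ‖z‖) * A r) (𝓝[<] 1) (𝓝 1) := by
    have h1 : Tendsto (fun r : ℝ => (r + ‖z‖) / (r - ‖z‖)) (𝓝[<] 1)
        (𝓝 ((1 + ‖z‖) / (1 - ‖z‖))) := by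
      refine Tendsto.mono_left ?_ nhdsWithin_le_nhds
      exact ((continuousAt_id.add continuousAt_const).div (continuousAt_id.sub continuousAt_const)
        (sub_pos.2 hz).ne').tendsto
    simpa using (h1.mul hu.tendsto_circleAverage_abs).const_add 1
  refine ge_of_tendsto hlim ?_
  filter_upwards [eventually_mem_Ioo (max_lt hz one_pos)] with r hr
  have hr0 : 0 < r := (le_max_right _ _).trans_lt hr.1
  have hzr : ‖z‖ < r := (le_max_left _ _).trans_lt hr.1
  have hint := hu.circleIntegrable_abs ⟨hr0, hr.2⟩
  have hint' : CircleIntegrable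
      (fun w => ((r + ‖z‖) / (r - ‖z‖)) • |‖discExt u w‖ - 1|) 0 r := hint.const_smul
  refine (norm_le_circleAverage_poissonKernel hr0 hr.2 hu.differentiableOn hzr).trans ?_
  have h1 : circleAverage (fun ζ => poissonKernel 0 z ζ * 1 +
      ((r + ‖z‖) / (r - ‖z‖)) • |‖discExt u ζ‖ - 1|) 0 r = 1 + (r + ‖z‖) / (r - ‖z‖) * A r := by
    rw [Real.circleAverage_fun_add
      (circleIntegrable_poissonKernel_mul hzr (circleIntegrable_const 1 0 r)) hint',
      circleAverage_poissonKernel_mul_const hzr]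
    congr 1
    exact Real.circleAverage_fun_smul
  rw [← h1]
  refine Real.circleAverage_mono (circleIntegrable_poissonKernel_mul hzr
    (circleIntegrable_of_continuousOn_ball hr0 hr.2 hu.differentiableOn.continuousOn.norm))
    ((circleIntegrable_poissonKernel_mul hzr (circleIntegrable_const 1 0 r)).add hint')
    fun ζ hζ => ?_
  rw [abs_of_pos hr0] at hζ
  have h2 := poissonKernel_le hζ hzr
  have h3 := poissonKernel_nonneg hζ hzr
  simp only [smul_eq_mul]
  nlinarith [le_abs_self (‖discExt u ζ‖ - 1), abs_nonneg (‖discExt u ζ‖ - 1)]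

/-- The boundary modulus of an inner function is `1` in the mean, also along the images of the
circles `|z| = r` under an automorphism of the disc. -/
theorem tendsto_circleAverage_comp (hu : IsInner u) {τ : Equiv.Perm 𝔻} (hτ : IsDiscAut τ) :
    Tendsto (fun r => circleAverage (fun w => 1 - ‖discExt u (discMap τ w)‖) 0 r)
      (𝓝[<] 1) (𝓝 0) := by
  -- `τ` does not carry radii to radii, so radial limits do not transfer to `U`. Instead, the mean
  -- over a fixed circle `|ζ| = R` is compared with the mean of `U` over `|z| = r` through a
  -- harmonic majorant of `|U|`.
  set U : ℂ → ℂ := fun w => discExt u (discMap τ w)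
  have hU : DifferentiableOn ℂ U (Metric.ball 0 1) :=
    hu.differentiableOn.comp hτ.differentiableOn (mapsTo_discMap τ _)
  have hU1 : ∀ w, ‖U w‖ ≤ 1 := fun w => hu.norm_discExt_le_one _
  set b := discMap τ.symm 0 with hb
  have hb1 : ‖b‖ < 1 := norm_discMap_lt _ _
  -- Lower bound for the Poisson kernel at `b` on circles of radius `r` with `(1 + |b|) / 2 < r <
  -- 1`: there `r - |b| > (1 - |b|) / 2` and `r + |b| < 2`.
  set c := (1 - ‖b‖) / 4 with hc
  have hc0 : 0 < c := by linarith
  rw [Metric.tendsto_nhds]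
  intro ε hε
  obtain ⟨R, hRε, hR⟩ := ((Metric.tendsto_nhds.1 hu.tendsto_circleAverage_abs (c * ε)
    (by positivity)).and (eventually_mem_Ioo one_pos)).exists
  -- With `R` fixed, compactness puts the image of `|z| ≤ R` under the inverse of `τ` inside `|w| <
  -- r` for all `r` near `1`.
  have hS : ContinuousOn (fun z => ‖discMap τ.symm z‖) (Metric.closedBall 0 R) :=
    (hτ.inv.differentiableOn.continuousOn.mono (Metric.closedBall_subset_ball hR.2)).norm
  obtain ⟨x, hx, hmax⟩ := (isCompact_closedBall (0 : ℂ) R).exists_isMaxOn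
    (Metric.nonempty_closedBall.2 hR.1.le) hS
  have hx1 : ‖discMap τ.symm x‖ < 1 := norm_discMap_lt _ _
  filter_upwards [eventually_mem_Ioo (max_lt hx1 (show (1 + ‖b‖) / 2 < 1 by linarith))] with r hr
  have hxr : ‖discMap τ.symm x‖ < r := (le_max_left _ _).trans_lt hr.1
  have hbr2 : (1 + ‖b‖) / 2 < r := (le_max_right _ _).trans_lt hr.1
  have hbr : ‖b‖ < r := by linarith
  have hr0 : 0 < r := (norm_nonneg b).trans_lt hbr
  have hUint : CircleIntegrable (fun ζ => ‖U ζ‖) 0 r :=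
    circleIntegrable_of_continuousOn_ball hr0 hr.2 hU.continuousOn.norm
  have hUint' : CircleIntegrable (fun ζ => 1 - ‖U ζ‖) 0 r :=
    (circleIntegrable_const 1 0 r).sub hUint
  -- `Re H` is the harmonic majorant of `|U|` in `|z| < r`. Composed with the inverse of `τ` it
  -- majorizes `|u|` on `|ζ| = R` and has value `Re H(b)` at the origin.
  set H := herglotzIntegral (fun ζ => ‖U ζ‖) r
  have hH : DifferentiableOn ℂ H (Metric.ball 0 r) := differentiableOn_herglotzIntegral hUint
  have hUH : ∀ z, ‖z‖ < r → ‖U z‖ ≤ (H z).re := fun z hz => by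
    rw [re_herglotzIntegral hUint hz]
    exact norm_le_circleAverage_poissonKernel hr0 hr.2 hU hz
  -- the mean value property of the Herglotz integral composed with the inverse of `τ`
  have hmv : circleAverage (fun ζ => (H (discMap τ.symm ζ)).re) 0 R = (H b).re := by
    have hcl : ∀ z ∈ Metric.closedBall (0 : ℂ) R, ‖discMap τ.symm z‖ < r := fun z hz =>
      lt_of_le_of_lt (by simpa using hmax hz) hxr
    have hd : DifferentiableOn ℂ (fun z => H (discMap τ.symm z))
        (discMap τ.symm ⁻¹' Metric.ball 0 r ∩ Metric.ball 0 1) :=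
      hH.comp (hτ.inv.differentiableOn.mono Set.inter_subset_right) fun z hz => hz.1
    have hsub : Metric.closedBall (0 : ℂ) R ⊆
        discMap τ.symm ⁻¹' Metric.ball 0 r ∩ Metric.ball 0 1 := fun z hz =>
      ⟨by simpa using hcl z hz, Metric.closedBall_subset_ball hR.2 hz⟩
    have hdc : DiffContOnCl ℂ (fun z => H (discMap τ.symm z)) (Metric.ball 0 |R|) := by
      rw [abs_of_pos hR.1]
      refine DifferentiableOn.diffContOnCl ?_
      rw [closure_ball _ hR.1.ne']
      exact hd.mono hsub
    have hint : CircleIntegrable (fun z => H (discMap τ.symm z)) 0 R :=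
      (hd.continuousOn.mono (Metric.sphere_subset_closedBall.trans hsub)).circleIntegrable hR.1.le
    have h1 := Complex.reCLM.circleAverage_comp_comm hint
    rw [hdc.circleAverage] at h1
    exact h1
  have h1 : 1 - c * ε < (H b).re := by
    rw [← hmv]
    have h2 : circleAverage (fun ζ => 1 - |‖discExt u ζ‖ - 1|) 0 R ≤
        circleAverage (fun ζ => (H (discMap τ.symm ζ)).re) 0 R := by
      refine Real.circleAverage_mono ((circleIntegrable_const 1 0 R).sub
        (hu.circleIntegrable_abs hR)) ?_ fun ζ hζ => ?_
      · refine ContinuousOn.circleIntegrable hR.1.le (Complex.continuous_re.comp_continuousOn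
          (hH.continuousOn.comp (hτ.inv.differentiableOn.continuousOn.mono
            (Metric.sphere_subset_closedBall.trans (Metric.closedBall_subset_ball hR.2))) ?_))
        intro z hz
        have : ‖discMap τ.symm z‖ ≤ _ := hmax (Metric.sphere_subset_closedBall hz)
        simpa using this.trans_lt hxr
      · rw [abs_of_pos hR.1] at hζ
        have hζ1 : ‖ζ‖ < 1 := by rw [mem_sphere_zero_iff_norm.1 hζ]; exact hR.2
        have h3 : ‖discMap τ.symm ζ‖ ≤ _ := hmax (Metric.sphere_subset_closedBall hζ)
        have h4 := hUH _ (h3.trans_lt hxr)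
        have h5 : U (discMap τ.symm ζ) = discExt u ζ := by
          simp only [U]; rw [discMap_apply_symm τ hζ1]
        rw [h5] at h4
        linarith [neg_abs_le (‖discExt u ζ‖ - 1)]
    rw [Real.circleAverage_fun_sub (circleIntegrable_const 1 0 R) (hu.circleIntegrable_abs hR),
      Real.circleAverage_const] at h2
    rw [Real.dist_eq, sub_zero] at hRε
    linarith [le_abs_self (circleAverage (fun w => |‖discExt u w‖ - 1|) 0 R)]
  -- `1 - Re H(b)` is the Poisson integral at `b` of the nonnegative function `1 - |U|`, and the
  -- kernel is at least `c`.
  have h2 : c * circleAverage (fun ζ => 1 - ‖U ζ‖) 0 r ≤ 1 - (H b).re := by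
    have h3 : circleAverage (fun ζ => c • (1 - ‖U ζ‖)) 0 r ≤
        circleAverage (fun ζ => poissonKernel 0 b ζ * (1 - ‖U ζ‖)) 0 r := by
      refine Real.circleAverage_mono hUint'.const_smul
        (circleIntegrable_poissonKernel_mul hbr hUint') fun ζ hζ => ?_
      rw [abs_of_pos hr0] at hζ
      refine mul_le_mul_of_nonneg_right (le_trans ?_ (le_poissonKernel hζ hbr))
        (sub_nonneg.2 (hU1 ζ))
      rw [le_div_iff₀ (by linarith [norm_nonneg b])]
      have := hr.2
      nlinarith [norm_nonneg b]
    rw [Real.circleAverage_fun_smul, smul_eq_mul] at h3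
    refine h3.trans_eq ?_
    simp only [mul_sub]
    rw [Real.circleAverage_fun_sub (circleIntegrable_poissonKernel_mul hbr
      (circleIntegrable_const 1 0 r)) (circleIntegrable_poissonKernel_mul hbr hUint),
      circleAverage_poissonKernel_mul_const hbr, re_herglotzIntegral hUint hbr]
  have h3 : 0 ≤ circleAverage (fun ζ => 1 - ‖U ζ‖) 0 r :=
    Real.circleAverage_nonneg_of_nonneg fun ζ _ => sub_nonneg.2 (hU1 ζ)
  rw [Real.dist_eq, sub_zero, abs_of_nonneg h3]
  exact lt_of_mul_lt_mul_left (by linarith) hc0.le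

end IsInner

/-! ### Lower bound by the outer part -/

theorem circleIntegrable_truncation {h : ℂ → ℝ} {c : ℂ} {R : ℝ} (hh : CircleIntegrable h c R)
    (N : ℝ) : CircleIntegrable (fun ζ => max (h ζ - N) 0) c R := by
  rw [CircleIntegrable, intervalIntegrable_iff] at hh ⊢
  exact (hh.sub (integrableOn_const (by simp [ENNReal.mul_eq_top]))).pos_part

theorem re_herglotzIntegral_nonneg {k : ℂ → ℝ} {R : ℝ} (hR : 0 < R) (hk : CircleIntegrable k 0 R)
    (hk0 : ∀ ζ, 0 ≤ k ζ) {z : ℂ} (hz : ‖z‖ < R) : 0 ≤ (herglotzIntegral k R z).re := by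
  rw [re_herglotzIntegral hk hz]
  refine Real.circleAverage_nonneg_of_nonneg fun ζ hζ => ?_
  rw [abs_of_pos hR] at hζ
  exact mul_nonneg (poissonKernel_nonneg hζ hz) (hk0 ζ)

/-- Since `h ≤ N + (h - N)⁺` and the Poisson kernel is positive of mean one. This replaces an upper
bound for `h`, which is only assumed integrable. -/
theorem re_herglotzIntegral_le {h : ℂ → ℝ} {R : ℝ} (hR : 0 < R) (hh : CircleIntegrable h 0 R)
    (N : ℝ) {z : ℂ} (hz : ‖z‖ < R) : (herglotzIntegral h R z).re ≤
      N + (herglotzIntegral (fun ζ => max (h ζ - N) 0) R z).re := by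
  have hN := circleIntegrable_truncation hh N
  have hc := circleIntegrable_poissonKernel_mul hz (circleIntegrable_const N 0 R)
  have hadd := Real.circleAverage_fun_add hc (circleIntegrable_poissonKernel_mul hz hN)
  rw [circleAverage_poissonKernel_mul_const hz N] at hadd
  rw [re_herglotzIntegral hh hz, re_herglotzIntegral hN hz, ← hadd]
  refine Real.circleAverage_mono (circleIntegrable_poissonKernel_mul hz hh)
    (hc.add (circleIntegrable_poissonKernel_mul hz hN)) fun ζ hζ => ?_
  rw [abs_of_pos hR] at hζ
  rw [← mul_add]
  exact mul_le_mul_of_nonneg_left (by linarith [le_max_left (h ζ - N) 0])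
    (poissonKernel_nonneg hζ hz)

theorem tendsto_re_herglotzIntegral_truncation {h : ℂ → ℝ} {R : ℝ} (hR : 0 < R)
    (hh : CircleIntegrable h 0 R) {z : ℂ} (hz : ‖z‖ < R) :
    Tendsto (fun N : ℕ => (herglotzIntegral (fun ζ => max (h ζ - N) 0) R z).re) atTop (𝓝 0) := by
  have hP : ∀ θ : ℝ, circleMap 0 R θ ∈ Metric.sphere (0 : ℂ) R := circleMap_mem_sphere 0 hR.le
  have h1 := intervalIntegral.tendsto_integral_filter_of_dominated_convergence
    (μ := volume) (a := 0) (b := 2 * Real.pi) (l := atTop)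
    (F := fun (N : ℕ) θ => poissonKernel 0 z (circleMap 0 R θ) * max (h (circleMap 0 R θ) - N) 0)
    (f := fun _ => (0 : ℝ))
    (fun θ => (R + ‖z‖) / (R - ‖z‖) * |h (circleMap 0 R θ)|)
    (Eventually.of_forall fun N => ((intervalIntegrable_iff.1
      (circleIntegrable_poissonKernel_mul hz
        (circleIntegrable_truncation hh N))).aestronglyMeasurable))
    (Eventually.of_forall fun N => Eventually.of_forall fun θ _ => by
      rw [Real.norm_eq_abs, abs_mul, abs_of_nonneg (poissonKernel_nonneg (hP θ) hz),
        abs_of_nonneg (le_max_right _ _)]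
      refine mul_le_mul (poissonKernel_le (hP θ) hz) (max_le ?_ (abs_nonneg _)) (le_max_right _ _)
        (div_nonneg (by positivity) (by linarith))
      linarith [le_abs_self (h (circleMap 0 R θ)), (Nat.cast_nonneg N : (0 : ℝ) ≤ N)])
    (hh.abs.const_mul _)
    (Eventually.of_forall fun θ _ => by
      refine tendsto_const_nhds.congr' ?_
      obtain ⟨N₀, hN₀⟩ := exists_nat_ge (h (circleMap 0 R θ))
      filter_upwards [eventually_ge_atTop N₀] with N hN
      have : (N₀ : ℝ) ≤ N := by exact_mod_cast hN
      rw [max_eq_right (by linarith), mul_zero])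
  have h2 := h1.const_smul (2 * Real.pi)⁻¹
  simp only [intervalIntegral.integral_zero, smul_zero] at h2
  refine h2.congr fun N => ?_
  rw [re_herglotzIntegral (circleIntegrable_truncation hh N) hz]
  rfl

/-- Induction on `1 - xy ≤ (1 - x) + (1 - y)`. It reduces a product of inner factors to the boundary
means of the single factors. -/
theorem one_sub_prod_le_sum {ι : Type*} (s : Finset ι) {x : ι → ℝ} (h0 : ∀ i, 0 ≤ x i)
    (h1 : ∀ i, x i ≤ 1) : 1 - ∏ i ∈ s, x i ≤ ∑ i ∈ s, (1 - x i) := by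
  classical
  induction s using Finset.induction_on with
  | empty => simp
  | insert i s hi ih =>
    rw [Finset.prod_insert hi, Finset.sum_insert hi]
    have h2 : ∏ i ∈ s, x i ≤ 1 := Finset.prod_le_one (fun i _ => h0 i) fun i _ => h1 i
    nlinarith [h1 i, h0 i]

/-- If `X * exp V ≤ M` with `X ≤ 1` and `V ≤ B + W` with `W ≥ 0`, then `V` is at most
`log M + ε`, up to an error controlled by `1 - X` and `W`. -/
theorem le_log_add_of_mul_exp_le {X V W B M ε : ℝ} (hX : X ≤ 1)
    (hε : 0 < ε) (hW : 0 ≤ W) (hXV : X * Real.exp V ≤ M) (hV : V ≤ B + W) :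
    V ≤ Real.log M + ε + |B - Real.log M| / (1 - Real.exp (-ε)) * (1 - X) + W := by
  have he : 0 < 1 - Real.exp (-ε) := by
    have := Real.exp_lt_one_iff.2 (show -ε < 0 by linarith)
    linarith
  -- If `X ≥ exp (-ε)`, taking logarithms costs only `ε`. Otherwise `1 - X` exceeds `1 - exp (-ε)`,
  -- and the term with `1 - X` pays for the crude bound `B`.
  rcases le_or_gt (Real.exp (-ε)) X with h | h
  · have hX' : 0 < X := (Real.exp_pos _).trans_le h
    have h1 := Real.log_le_log (by positivity) hXV
    rw [Real.log_mul hX'.ne' (Real.exp_pos V).ne', Real.log_exp] at h1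
    have h2 := Real.log_le_log (Real.exp_pos _) h
    rw [Real.log_exp] at h2
    have h3 : 0 ≤ |B - Real.log M| / (1 - Real.exp (-ε)) * (1 - X) :=
      mul_nonneg (by positivity) (by linarith)
    linarith
  · have h1 : |B - Real.log M| ≤ |B - Real.log M| / (1 - Real.exp (-ε)) * (1 - X) := by
      rw [div_mul_eq_mul_div, le_div_iff₀ he]
      exact mul_le_mul_of_nonneg_left (by linarith) (abs_nonneg _)
    linarith [le_abs_self (B - Real.log M)]

/-- A bounded product of inner and outer functions moved by automorphisms `τ j` of the disc with
`τ j 0 = a` bounds its outer factor at the point `a`. -/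
theorem IsInner.nsmul_re_herglotzIntegral_le_log {u : 𝔻 → ℂ} (hu : IsInner u) {h : ℂ → ℝ}
    (hh : CircleIntegrable h 0 1) {τ : ℕ → Equiv.Perm 𝔻} (hτ : ∀ j, IsDiscAut (τ j)) {a : 𝔻}
    (ha : ∀ j, τ j 0 = a) {n : ℕ} {M : ℝ}
    (hle : ∀ z : 𝔻, (∏ j ∈ Finset.range n, ‖u (τ j z)‖) *
      Real.exp (∑ j ∈ Finset.range n, (herglotzIntegral h 1 (τ j z)).re) ≤ M) :
    n * (herglotzIntegral h 1 a).re ≤ Real.log M := by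
  set T : ℕ → ℂ → ℂ := fun j => discMap (τ j)
  have hT0 : ∀ j, T j 0 = a := fun j => by simpa [ha] using discMap_coe (τ j) 0
  have hTn : ∀ j z, ‖T j z‖ < 1 := fun j z => norm_discMap_lt _ _
  have hTd : ∀ j, DifferentiableOn ℂ (T j) (Metric.ball 0 1) := fun j => (hτ j).differentiableOn
  have hHd : ∀ {k : ℂ → ℝ}, CircleIntegrable k 0 1 → ∀ j,
      DifferentiableOn ℂ (fun z => herglotzIntegral k 1 (T j z)) (Metric.ball 0 1) :=
    fun hk j => (differentiableOn_herglotzIntegral hk).comp (hTd j) (mapsTo_discMap _ _)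
  have hHi : ∀ {k : ℂ → ℝ}, CircleIntegrable k 0 1 → ∀ j, ∀ r ∈ Set.Ioo (0 : ℝ) 1,
      CircleIntegrable (fun z => (herglotzIntegral k 1 (T j z)).re) 0 r := fun hk j r hr =>
    circleIntegrable_of_continuousOn_ball hr.1 hr.2
      (Complex.continuous_re.comp_continuousOn (hHd hk j).continuousOn)
  -- Every `τ j` sends `0` to `a`, so each of the `n` harmonic summands has mean equal to its value
  -- at `a`.
  have hHa : ∀ {k : ℂ → ℝ}, CircleIntegrable k 0 1 → ∀ r ∈ Set.Ioo (0 : ℝ) 1,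
      circleAverage (fun z => ∑ j ∈ Finset.range n, (herglotzIntegral k 1 (T j z)).re) 0 r =
        n * (herglotzIntegral k 1 a).re := by
    intro k hk r hr
    rw [Real.circleAverage_fun_sum fun j _ => hHi hk j r hr]
    simp [fun j => circleAverage_re_eq hr.1 hr.2 (hHd hk j), hT0]
  have hUi : ∀ j, ∀ r ∈ Set.Ioo (0 : ℝ) 1,
      CircleIntegrable (fun z => 1 - ‖discExt u (T j z)‖) 0 r := fun j r hr =>
    circleIntegrable_of_continuousOn_ball hr.1 hr.2 (continuousOn_const.sub
      (hu.differentiableOn.comp (hTd j) (mapsTo_discMap _ _)).continuousOn.norm)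
  have key : ∀ ε > 0, ∀ N : ℕ, n * (herglotzIntegral h 1 a).re ≤
      Real.log M + ε + n * (herglotzIntegral (fun ζ => max (h ζ - N) 0) 1 a).re := by
    intro ε hε N
    have hN := circleIntegrable_truncation hh N
    set C := |n * (N : ℝ) - Real.log M| / (1 - Real.exp (-ε))
    have hC0 : 0 ≤ C := div_nonneg (abs_nonneg _) (by
      have := Real.exp_lt_one_iff.2 (show -ε < 0 by linarith)
      linarith)
    -- Averaged over `|z| = r`, the `C` term vanishes as `r → 1`, while the truncation term has the
    -- exact mean given by `hHa`. The bound `B = n * N` comes from truncating each of the `n`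
    -- summands at `N`.
    have hpt : ∀ z : ℂ, ‖z‖ < 1 → ∑ j ∈ Finset.range n, (herglotzIntegral h 1 (T j z)).re ≤
        (Real.log M + ε + C • ∑ j ∈ Finset.range n, (1 - ‖discExt u (T j z)‖)) +
          ∑ j ∈ Finset.range n, (herglotzIntegral (fun ζ => max (h ζ - N) 0) 1 (T j z)).re := by
      intro z hz
      have h1 := hle (.mk z hz)
      simp only [← discExt_coe u, ← discMap_coe, Complex.UnitDisc.coe_mk] at h1
      have h2 := le_log_add_of_mul_exp_le
        (Finset.prod_le_one (fun j _ => norm_nonneg _) fun j _ => hu.norm_discExt_le_one _) hε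
        (W := ∑ j ∈ Finset.range n, (herglotzIntegral (fun ζ => max (h ζ - N) 0) 1 (T j z)).re)
        (B := n * (N : ℝ))
        (Finset.sum_nonneg fun j _ => re_herglotzIntegral_nonneg one_pos hN
          (fun ζ => le_max_right _ _) (hTn j z)) h1 (by
            refine (Finset.sum_le_sum fun j _ =>
              re_herglotzIntegral_le one_pos hh N (hTn j z)).trans_eq ?_
            rw [Finset.sum_add_distrib]
            simp)
      refine h2.trans ?_
      have h3 := one_sub_prod_le_sum (Finset.range n) (x := fun j => ‖discExt u (T j z)‖)
        (fun j => norm_nonneg _) fun j => hu.norm_discExt_le_one _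
      simp only [smul_eq_mul]
      have h4 := mul_le_mul_of_nonneg_left h3 hC0
      linarith
    have hr : ∀ r ∈ Set.Ioo (0 : ℝ) 1, n * (herglotzIntegral h 1 a).re ≤
        Real.log M + ε + C • ∑ j ∈ Finset.range n,
          circleAverage (fun z => 1 - ‖discExt u (T j z)‖) 0 r +
          n * (herglotzIntegral (fun ζ => max (h ζ - N) 0) 1 a).re := by
      intro r hr
      have i1 : CircleIntegrable (fun z => ∑ j ∈ Finset.range n,
          (herglotzIntegral h 1 (T j z)).re) 0 r :=
        CircleIntegrable.fun_sum _ fun j _ => hHi hh j r hr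
      have i2 : CircleIntegrable (fun z => ∑ j ∈ Finset.range n,
          (herglotzIntegral (fun ζ => max (h ζ - N) 0) 1 (T j z)).re) 0 r :=
        CircleIntegrable.fun_sum _ fun j _ => hHi hN j r hr
      have i3 : CircleIntegrable (fun z => C • ∑ j ∈ Finset.range n,
          (1 - ‖discExt u (T j z)‖)) 0 r :=
        CircleIntegrable.const_smul (CircleIntegrable.fun_sum _ fun j _ => hUi j r hr)
      have i4 : CircleIntegrable (fun z => Real.log M + ε + C • ∑ j ∈ Finset.range n,
          (1 - ‖discExt u (T j z)‖)) 0 r := (circleIntegrable_const _ 0 r).add i3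
      rw [← hHa hh r hr, ← hHa hN r hr]
      refine (Real.circleAverage_mono i1 (i4.add i2) fun z hz => hpt z ?_).trans_eq ?_
      · rw [abs_of_pos hr.1, mem_sphere_zero_iff_norm] at hz
        rw [hz]; exact hr.2
      · rw [Real.circleAverage_add i4 i2, Real.circleAverage_fun_add (circleIntegrable_const _ 0 r)
          i3, Real.circleAverage_const, Real.circleAverage_fun_smul,
          Real.circleAverage_fun_sum fun j _ => hUi j r hr]
    have hlim : Tendsto (fun r : ℝ => Real.log M + ε + C • ∑ j ∈ Finset.range n,
          circleAverage (fun z => 1 - ‖discExt u (T j z)‖) 0 r +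
          n * (herglotzIntegral (fun ζ => max (h ζ - N) 0) 1 a).re) (𝓝[<] 1)
        (𝓝 (Real.log M + ε + C • ∑ j ∈ Finset.range n, 0 +
          n * (herglotzIntegral (fun ζ => max (h ζ - N) 0) 1 a).re)) :=
      (((tendsto_finsetSum _ fun j _ => hu.tendsto_circleAverage_comp (hτ j)).const_smul
        C).const_add _).add_const _
    simp only [Finset.sum_const_zero, smul_zero, add_zero] at hlim
    refine ge_of_tendsto hlim ?_
    filter_upwards [eventually_mem_Ioo one_pos] with r hr' using hr r hr'
  -- `C` depends on `N` and `ε`, so `r → 1` was taken with both fixed; now `N → ∞`, and `ε` is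
  -- arbitrary.
  refine le_of_forall_pos_le_add fun ε hε => ?_
  have hlim := ((tendsto_re_herglotzIntegral_truncation one_pos hh a.norm_lt_one).const_mul
    (n : ℝ)).const_add (Real.log M + ε)
  rw [mul_zero, add_zero] at hlim
  exact ge_of_tendsto' hlim (key ε hε)

/-- The preceding bound with `τ_j = φ_j ∘ σ`, where `σ` is the Möbius map with `σ 0 = a`: recentring
at the fixed point makes every factor contribute the same value `log |v a|`. -/
theorem norm_pow_le_supNorm_cocycle {φ : Equiv.Perm 𝔻} (hφ : IsDiscAut φ) {a : 𝔻} (ha : φ a = a)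
    {ψ v : 𝔻 → ℂ} (hψ : IsHInfty ψ) (hv : IsOuterPart ψ v) (n : ℕ) :
    ‖v a‖ ^ n ≤ supNorm (cocycle ψ φ n) := by
  obtain ⟨⟨c, h, hc, hh, hvh⟩, u, hu, huv⟩ := hv
  have hvn : ∀ z : 𝔻, ‖v z‖ = Real.exp (herglotzIntegral h 1 z).re := fun z => by
    rw [hvh z, norm_mul, hc, one_mul, Complex.norm_exp]
    rfl
  -- Any `M` strictly above the sup norm is positive, so `exp (log M) = M` without first showing
  -- that the cocycle is nonzero.
  refine le_of_forall_gt_imp_ge_of_dense fun M hM => ?_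
  have hM0 : 0 < M := (supNorm_nonneg _).trans_lt hM
  have key := hu.nsmul_re_herglotzIntegral_le_log hh (τ := fun j => φ ^ j * mobius a) (a := a)
    (fun j => (hφ.pow j).mul (isDiscAut_mobius a)) (fun j => by
      rw [Equiv.Perm.mul_apply, mobius_zero, ← Equiv.Perm.iterate_eq_pow]
      exact Function.iterate_fixed ha j) (n := n) (fun z => by
      refine le_trans (le_of_eq ?_)
        ((norm_le_supNorm (hψ.cocycle hφ n) (mobius a z)).trans hM.le)
      rw [Real.exp_sum, ← Finset.prod_mul_distrib, cocycle, norm_prod]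
      refine Finset.prod_congr rfl fun j _ => ?_
      rw [← hvn, ← norm_mul, ← huv, Equiv.Perm.mul_apply, ← Equiv.Perm.iterate_eq_pow])
  rw [hvn, ← Real.exp_nat_mul]
  exact (Real.exp_le_exp.2 key).trans_eq (Real.exp_log hM0)

end WeightedComp

end

theorem proposition4p2 (p α : ℝ) [Fact (1 ≤ p)] [Fact (-1 < α)]
    (φ : Equiv.Perm 𝔻) (hφ : WeightedComp.IsEllipticAut φ) (hord : ¬ IsOfFinOrder φ)
    (ψ : 𝔻 → ℂ) (hψ : WeightedComp.IsHInfty ψ) :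
    ∃ ρ : ℝ,
      Tendsto (fun n : ℕ => WeightedComp.supNorm (WeightedComp.cocycle ψ φ n) ^ (1 / (n : ℝ)))
        atTop (𝓝 ρ) ∧
      (∃ T : WeightedComp.Bergman p α →L[ℂ] WeightedComp.Bergman p α,
        (∀ f z, T f z = ψ z * f (φ z)) ∧ spectralRadius ℂ T = ENNReal.ofReal ρ) ∧
      (∀ a : 𝔻, φ a = a → ∀ v : 𝔻 → ℂ, WeightedComp.IsOuterPart ψ v → ‖v a‖ ≤ ρ) := by
  obtain ⟨b, hb, -⟩ := hφ.unique_fixed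
  obtain ⟨ρ, hρ, hT⟩ := WeightedComp.exists_tendsto_and_spectralRadius p α hφ.isDiscAut hb hψ
  refine ⟨ρ, hρ, hT, fun a ha v hv => ge_of_tendsto hρ ?_⟩
  -- At `n = 0` the exponent `1 / n` is the default `0`, so the root identity needs `n ≠ 0`.
  filter_upwards [eventually_ne_atTop 0] with n hn
  calc ‖v a‖ = (‖v a‖ ^ n) ^ (1 / (n : ℝ)) := by
        rw [one_div, Real.pow_rpow_inv_natCast (norm_nonneg _) hn]
    _ ≤ _ := Real.rpow_le_rpow (by positivity)
        (WeightedComp.norm_pow_le_supNorm_cocycle hφ.isDiscAut ha hψ hv n) (by positivity)
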